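/- Let $p\ge 1$ be an integer. There are constants $C_1,C_2>0$ depending only on $p$ such that the following holds. Setting. Let $\mathcal Z\subset\mathbb R^d$ be nonempty, compact and convex with diameter $D=\sup_{z,z'\in\mathcal Z}\|z-z'\|$ (Euclidean norm), and let $\mathcal N_{\mathcal Z}(z)=\{u:\langle u,w-z\rangle\le 0\ \forall w\in\mathcal Z\}$. Let $h:\mathcal Z\to\mathbb R$ be differentiable on $\mathcal Z$ with gradient $\nabla h$ and, for some $\mu>0$, $(p+1)$-th-order $\mu$-uniformly convex: $$h(z)\ge h(z')+\langle\nabla h(z'),z-z'\rangle+\tfrac{\mu}{p+1}\|z-z'\|^{p+1}\qquad\forall z,z'\in\mathcal Z .$$ Let $\gamma>0$, $\epsilon>0$, $\delta\ge 0$, and let the following oracles be given on $\mathcal Z$: $\mathrm{iFunc}(z)\in\mathbb R$ with $|\mathrm{iFunc}(z)-h(z)|\le\delta$; $\mathrm{iGrad}(z)\in\mathbb R^d$ with $\|\mathrm{iGrad}(z)-\nabla h(z)\|\le\delta$; and $\mathrm{iProx}(\bar z)=(z,u)$ with $z\in\mathcal Z$, $u\in\mathcal N_{\mathcal Z}(z)$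 and $$\|\nabla h(z)+u+\lambda(z-\bar z)\|\le\tfrac{\lambda}{2}\|z-\bar z\|+\delta,\qquad \lambda=\gamma\|z-\bar z\|^{p-1}$$ (with $0^0=1$). Algorithm (AIPE-restart with $S$ epochs of length $T$, started at $z^{(0)}\in\mathcal Z$). Epoch $s=0,\dots,S-1$ starts with $z_0=v_0=z^{(s)}$, $A_0=0$ and $\lambda_1'=\lambda_1$, where $\lambda_1=\gamma\|\tilde z_1-z^{(s)}\|^{p-1}$ and $\tilde z_1$ is the point returned by $\mathrm{iProx}(z^{(s)})$. If $\lambda_1=0$ (so that $\tilde z_1=z^{(s)}$), the epoch ends with $z^{(s+1)}=z^{(s)}$. Otherwise, for $t=0,\dots,T-1$: let $a_{t+1}'>0$ solve $A_t+a_{t+1}'=2\lambda_{t+1}'(a_{t+1}')^2$, and put $$A_{t+1}'=A_t+a_{t+1}',\quad \bar z_t=\tfrac{A_t}{A_{t+1}'}z_t+\tfrac{a_{t+1}'}{A_{t+1}'}v_t,\quad (\tilde z_{t+1},u_{t+1})=\mathrm{iProx}(\bar z_t),\quad \lambda_{t+1}=\gamma\|\tilde z_{t+1}-\bar z_t\|^{p-1};$$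 if $\lambda_{t+1}\le\lambda_{t+1}'$, put $\gamma_{t+1}=1$ and $\lambda_{t+2}'=\lambda_{t+1}'/2$; otherwise put $\gamma_{t+1}=\lambda_{t+1}'/\lambda_{t+1}$ and $\lambda_{t+2}'=2\lambda_{t+1}'$; then $$a_{t+1}=\gamma_{t+1}a_{t+1}',\quad A_{t+1}=A_t+a_{t+1},\quad z_{t+1}=\tfrac{(1-\gamma_{t+1})A_t}{A_{t+1}}z_t+\tfrac{\gamma_{t+1}A_{t+1}'}{A_{t+1}}\tilde z_{t+1},$$ $$v_{t+1}=\mathrm{Proj}_{\mathcal Z}\big(v_t-a_{t+1}(\mathrm{iGrad}(\tilde z_{t+1})+u_{t+1})\big).$$ The epoch's output $z^{(s+1)}$ is a point with the lowest value of $\mathrm{iFunc}$ among $z_0,\dots,z_T,\tilde z_1,\dots,\tilde z_T$ (ties broken arbitrarily). The algorithm returns $z^{(S)}$. Claim. Let $z^*\in\arg\min_{\mathcal Z}h$ and $\Delta=h(z^{(0)})-h(z^*)$, and suppose (if $\Delta>0$) that $$\delta\le\min\left\{\frac{(1+\sqrt{17})\,\epsilon^2\min\left\{D,\left(\frac{(p+1)\epsilon^2}{2\mu\Delta}\right)^{\frac1{p+1}}\right\}}{2^7(7+\sqrt6)D^2\Delta},\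 \frac{\epsilon^2}{2^4\max\{D,1\}\Delta}\right\}.$$ Run the algorithm with $T=\lceil C_1(\gamma/\mu)^{2/(3p+1)}\rceil$ and $S=\lceil\log_2(\Delta/\epsilon)\rceil$ (read as $0$ if $\Delta\le\epsilon$). Then every run returns a point $z^{(S)}\in\mathcal Z$ with $h(z^{(S)})-h(z^*)\le\epsilon$. Moreover $T\le C_2\max\{1,(\gamma/\mu)^{2/(3p+1)}\}$, and the total number of iterations satisfies $TS\le C_2\max\{1,(\gamma/\mu)^{2/(3p+1)}\}$ if $\Delta\le 2\epsilon$ and $TS\le C_2\max\{1,(\gamma/\mu)^{2/(3p+1)}\}\log_2(\Delta/\epsilon)$ if $\Delta>2\epsilon$. -/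

import Mathlib

noncomputable section

namespace AIPE

set_option linter.unusedSectionVars false

variable {E : Type*} [NormedAddCommGroup E] [InnerProductSpace ℝ E]

/-- The normal cone of `Z` at `z`. -/
def normalCone (Z : Set E) (z : E) : Set E :=
  {u | ∀ w ∈ Z, inner ℝ u (w - z) ≤ 0}

/-- The Euclidean projection onto `Z`: a point of `Z` nearest to `y` (it exists and is unique when
`Z` is nonempty, compact and convex). -/
def proj (Z : Set E) (y : E) : E :=
  Classical.epsilon fun w => w ∈ Z ∧ ∀ w' ∈ Z, ‖y - w‖ ≤ ‖y - w'‖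

theorem proj_spec {Z : Set E} (hZ : IsCompact Z) (hne : Z.Nonempty) (y : E) :
    proj Z y ∈ Z ∧ ∀ w' ∈ Z, ‖y - proj Z y‖ ≤ ‖y - w'‖ := by
  obtain ⟨w, hw, hmin⟩ := hZ.exists_isMinOn hne
    (f := fun w => ‖y - w‖) (by fun_prop)
  exact Classical.epsilon_spec
    (p := fun w => w ∈ Z ∧ ∀ w' ∈ Z, ‖y - w‖ ≤ ‖y - w'‖) ⟨w, hw, fun w' hw' => hmin hw'⟩

/-- `q`-th-order `μ`-uniform convexity on `Z` of a function `h` with gradient field `grad`. -/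
def UniformlyConvexOn (q : ℕ) (μ : ℝ) (Z : Set E) (h : E → ℝ) (grad : E → E) : Prop :=
  ∀ z ∈ Z, ∀ z' ∈ Z,
    h z' + inner ℝ (grad z') (z - z') + μ / q * ‖z - z'‖ ^ q ≤ h z

/-- `iFunc` is a `δ`-zeroth-order oracle of `h` on `Z`. -/
def IsZerothOrderOracle (Z : Set E) (h : E → ℝ) (δ : ℝ) (iFunc : E → ℝ) : Prop :=
  ∀ z ∈ Z, |iFunc z - h z| ≤ δ

/-- `iGrad` is a `δ`-first-order oracle on `Z` of a function with gradient field `grad`. -/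
def IsFirstOrderOracle (Z : Set E) (grad : E → E) (δ : ℝ) (iGrad : E → E) : Prop :=
  ∀ z ∈ Z, ‖iGrad z - grad z‖ ≤ δ

/-- The proximal weight `λ = γ ‖z - zbar‖ ^ (p - 1)`. -/
def proxWeight (p : ℕ) (γ : ℝ) (z zbar : E) : ℝ := γ * ‖z - zbar‖ ^ (p - 1)

/-- `iProx` is a `(δ, γ)`-`p`-th-order proximal oracle on `Z`: at `zbar` it returns a pair `(z, u)`
with `z ∈ Z`, `u` in the normal cone at `z`, and
`‖∇h(z) + u + λ (z - zbar)‖ ≤ (λ / 2) ‖z - zbar‖ + δ`. -/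
def IsProxOracle (p : ℕ) (Z : Set E) (grad : E → E) (δ γ : ℝ) (iProx : E → E × E) : Prop :=
  ∀ zbar ∈ Z,
    (iProx zbar).1 ∈ Z ∧ (iProx zbar).2 ∈ normalCone Z (iProx zbar).1 ∧
      ‖grad (iProx zbar).1 + (iProx zbar).2
          + proxWeight p γ (iProx zbar).1 zbar • ((iProx zbar).1 - zbar)‖
        ≤ proxWeight p γ (iProx zbar).1 zbar / 2 * ‖(iProx zbar).1 - zbar‖ + δ

/-- The positive solution `a` of `A + a = 2 * lam * a ^ 2`. -/
def stepRoot (A lam : ℝ) : ℝ := (1 + √(1 + 8 * lam * A)) / (4 * lam)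

theorem stepRoot_iff {A lam : ℝ} (hA : 0 ≤ A) (hl : 0 < lam) (a : ℝ) :
    (0 < a ∧ A + a = 2 * lam * a ^ 2) ↔ a = stepRoot A lam := by
  have hs : √(1 + 8 * lam * A) ^ 2 = 1 + 8 * lam * A := Real.sq_sqrt (by positivity)
  have hs1 : 0 ≤ √(1 + 8 * lam * A) := Real.sqrt_nonneg _
  unfold stepRoot
  constructor
  · rintro ⟨ha, h⟩
    have hge : 1 ≤ 4 * lam * a := by
      have : a * 1 ≤ a * (2 * lam * a) := by nlinarith
      have := le_of_mul_le_mul_left this ha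
      nlinarith [mul_pos hl ha]
    have : √(1 + 8 * lam * A) = 4 * lam * a - 1 := by
      rw [show 1 + 8 * lam * A = (4 * lam * a - 1) ^ 2 by
        rw [show A = 2 * lam * a ^ 2 - a by linarith]; ring]
      exact Real.sqrt_sq (by linarith)
    rw [this]; field_simp; ring
  · rintro rfl
    refine ⟨by positivity, ?_⟩
    generalize √(1 + 8 * lam * A) = r at hs hs1
    obtain rfl : A = (r ^ 2 - 1) / (8 * lam) := by
      rw [eq_div_iff (by positivity)]; linarith
    field_simp
    ring

/-- The variables carried from one inner iteration to the next: `z = z_t`, `zt = z̃_t`, `v = v_t`,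
`A = A_t`, and `lamP = λ'_{t+1}`. -/
structure State (E : Type*) where
  z : E
  zt : E
  v : E
  A : ℝ
  lamP : ℝ

/-- Start of an epoch at `z0`: `z_0 = v_0 = z0`, `A_0 = 0`, and `λ'_1 = λ_1`. Since `z_0 = v_0`, the
first prox centre is `z0` whatever the value of `a'_1`, so `λ_1` is known before `a'_1` is computed.
There is no prox output before the first iteration; by convention `z̃_0 = z0`. -/
def init (p : ℕ) (γ : ℝ) (iProx : E → E × E) (z0 : E) : State E where
  z := z0
  zt := z0
  v := z0
  A := 0
  lamP := proxWeight p γ (iProx z0).1 z0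

/-- One inner iteration of the search-free Monteiro–Svaiter acceleration. -/
def step (p : ℕ) (γ : ℝ) (Z : Set E) (iGrad : E → E) (iProx : E → E × E) (x : State E) :
    State E :=
  let aP := stepRoot x.A x.lamP
  let AP := x.A + aP
  let zbar := (x.A / AP) • x.z + (aP / AP) • x.v
  let zt := (iProx zbar).1
  let u := (iProx zbar).2
  let lam := proxWeight p γ zt zbar
  let θ := if lam ≤ x.lamP then 1 else x.lamP / lam
  let a := θ * aP
  let A := x.A + a
  { z := ((1 - θ) * x.A / A) • x.z + (θ * AP / A) • zt
    zt := zt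
    v := proj Z (x.v - a • (iGrad zt + u))
    A := A
    lamP := if lam ≤ x.lamP then x.lamP / 2 else 2 * x.lamP }

/-- The state after `t` inner iterations of an epoch started at `z0`. -/
def epochState (p : ℕ) (γ : ℝ) (Z : Set E) (iGrad : E → E) (iProx : E → E × E) (z0 : E) (t : ℕ) :
    State E :=
  (step p γ Z iGrad iProx)^[t] (init p γ iProx z0)

/-- The number of inner iterations completed in an epoch: `T`, unless `λ_1 = 0`. In that case the
equation for `a'_1` has no positive solution and the epoch is broken off; the only points generated
are then `z_0` and `z̃_1`, and these are both equal to `z0`. -/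
def epochLength (p : ℕ) (γ : ℝ) (iProx : E → E × E) (T : ℕ) (z0 : E) : ℕ :=
  open Classical in if (init p γ iProx z0).lamP = 0 then 0 else T

/-- The points `z_t` and `z̃_t` among which the result of an epoch is selected. -/
def candidates (p : ℕ) (γ : ℝ) (Z : Set E) (iGrad : E → E) (iProx : E → E × E) (T : ℕ) (z0 : E) :
    Set E :=
  {w | ∃ t ≤ epochLength p γ iProx T z0,
    w = (epochState p γ Z iGrad iProx z0 t).z ∨ w = (epochState p γ Z iGrad iProx z0 t).zt}

/-- `z1` is a possible result of an epoch of length `T` started at `z0`: a candidate with the lowest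
recorded value (ties may be broken in any way). -/
def IsEpochOutput (p : ℕ) (γ : ℝ) (Z : Set E) (iFunc : E → ℝ) (iGrad : E → E) (iProx : E → E × E)
    (T : ℕ) (z0 z1 : E) : Prop :=
  z1 ∈ candidates p γ Z iGrad iProx T z0 ∧
    ∀ w ∈ candidates p γ Z iGrad iProx T z0, iFunc z1 ≤ iFunc w

/-- `zs 0, …, zs S` are the restart points of a run of AIPE-restart from `z0` with `S` epochs of
length `T`; the run returns `zs S`. -/
def IsRun (p : ℕ) (γ : ℝ) (Z : Set E) (iFunc : E → ℝ) (iGrad : E → E) (iProx : E → E × E)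
    (T S : ℕ) (z0 : E) (zs : ℕ → E) : Prop :=
  zs 0 = z0 ∧ ∀ s < S, IsEpochOutput p γ Z iFunc iGrad iProx T (zs s) (zs (s + 1))

/-- The algorithm always runs to completion. -/
theorem exists_isRun (p : ℕ) (γ : ℝ) (Z : Set E) (iFunc : E → ℝ) (iGrad : E → E)
    (iProx : E → E × E) (T S : ℕ) (z0 : E) :
    ∃ zs, IsRun p γ Z iFunc iGrad iProx T S z0 zs := by
  have h : ∀ x, ∃ y, IsEpochOutput p γ Z iFunc iGrad iProx T x y := by
    intro x
    have hfin : (candidates p γ Z iGrad iProx T x).Finite := by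
      refine ((Set.finite_Iic (epochLength p γ iProx T x)).biUnion fun t _ =>
        Set.toFinite {(epochState p γ Z iGrad iProx x t).z,
          (epochState p γ Z iGrad iProx x t).zt}).subset ?_
      rintro w ⟨t, ht, hw⟩
      simp only [Set.mem_iUnion, Set.mem_Iic, Set.mem_insert_iff, Set.mem_singleton_iff]
      exact ⟨t, ht, hw⟩
    obtain ⟨y, hy, hmin⟩ := Set.exists_min_image _ iFunc hfin ⟨_, 0, Nat.zero_le _, Or.inl rfl⟩
    exact ⟨y, hy, hmin⟩
  choose f hf using h
  refine ⟨fun s => f^[s] z0, rfl, fun s _ => ?_⟩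
  simp only [Function.iterate_succ_apply']
  exact hf _

/-- The admissible size of the oracle error. -/
def errorThreshold (p : ℕ) (μ D Δ ε : ℝ) : ℝ :=
  min
    ((1 + √17) * ε ^ 2 * min D (((p + 1) * ε ^ 2 / (2 * μ * Δ)) ^ (1 / ((p : ℝ) + 1)))
      / (2 ^ 7 * (7 + √6) * D ^ 2 * Δ))
    (ε ^ 2 / (2 ^ 4 * max D 1 * Δ))

/-- The rate `(γ / μ) ^ (2 / (3 p + 1))`. -/
def rate (p : ℕ) (γ μ : ℝ) : ℝ := (γ / μ) ^ (2 / (3 * (p : ℝ) + 1))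

/-- The number of epochs `S = ⌈log₂ (Δ / ε)⌉` (and `0` if `Δ ≤ ε`). -/
def numEpochs (Δ ε : ℝ) : ℕ := ⌈Real.logb 2 (Δ / ε)⌉₊

end AIPE

end

noncomputable section

namespace AIPE

set_option linter.unusedSectionVars false

/-! Each epoch halves the optimality gap, up to an error below ε, so ⌈log₂(Δ/ε)⌉ epochs suffice. Let
an epoch start with gap e, at distance R from z*. If some proximal step has λ‖z̃ - z̄‖ ≤ 4δ, its
output is nearly stationary and within 7δD of optimal (`sub_le_of_short_step`). Otherwise the steps
dominate the oracle error, and A(h(z) - h*) + ‖v - z*‖²/2 drops in each step by 3/16 of `movement`,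
up to the gradient error (`lyapunov_step_le`). The final gap is then at most R²/(2A_T) + δD, which
is small once A_T e ≥ 4R².

If A_T e < 4R², the total movement is at most (3R)², and uniform convexity, e ≥ μR^(p+1)/(p+1),
gives A_T R^(p-1) < 4(p+1)/μ. For T of order (γ/μ)^(2/(3p+1)) this contradicts the growth bound A_T
γ ρ^(p-1) ≳ T^((3p+1)/2) with ρ = 3R (`exists_pow_le_of_movement_le`).

The growth bound concerns scalars only. Each step halves or doubles the guess L. With few doublings
L decays geometrically, and A L ≥ 1/4 makes A grow exponentially. With many, each doubling is
charged to the growth of A^(1/(p+1)) (`sum_gain_le`), and bounded movement makes these charges large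
on average. -/

/-! ### Power inequalities for a single step. -/

/-- A lower bound linear in x, so that it can be summed over steps in place of Jensen's inequality.
For x ≥ 1 the worst exponent is s = 1. -/
theorem one_sub_half_le_rpow_neg {x s : ℝ} (hx : 0 < x) (hs : 0 ≤ s) (hs1 : s ≤ 1) :
    1 - x / 2 ≤ x ^ (-s) := by
  rcases le_total x 1 with h1 | h1
  · have : 1 ≤ x ^ (-s) := Real.one_le_rpow_of_pos_of_le_one_of_nonpos hx h1 (by linarith)
    linarith
  · have h2 : x ^ (-1 : ℝ) ≤ x ^ (-s) := Real.rpow_le_rpow_of_exponent_le h1 (by linarith)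
    rw [Real.rpow_neg_one] at h2
    have h3 : 1 - x / 2 ≤ x⁻¹ := by
      rw [← one_div, le_div_iff₀ hx]
      nlinarith [sq_nonneg (x - 1)]
    linarith

/-- The amount by which `A ^ (1 / (p + 1))` grows (up to a constant) in a full step with proximal
weight `L` that ends at `A`. -/
def gain (p : ℕ) (A L : ℝ) : ℝ :=
  A ^ (-((p : ℝ) - 1) / (2 * (p + 1))) * L ^ (-(1 / 2) : ℝ)

theorem gain_nonneg (p : ℕ) {A L : ℝ} (hA : 0 ≤ A) (hL : 0 ≤ L) : 0 ≤ gain p A L := by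
  unfold gain; positivity

theorem gain_half (p : ℕ) {A L : ℝ} (hL : 0 < L) : gain p A (L / 2) = √2 * gain p A L := by
  unfold gain
  rw [Real.div_rpow hL.le (by norm_num), Real.rpow_neg (by norm_num : (0 : ℝ) ≤ 2),
    ← Real.sqrt_eq_rpow]
  field_simp

theorem gain_double_le {p : ℕ} (hp : 1 ≤ p) {A B L : ℝ} (hA : 0 < A) (hAB : A ≤ B) (hL : 0 < L) :
    gain p B (2 * L) ≤ 3 / 4 * gain p A L := by
  have h1 : gain p B (2 * L) ≤ gain p A (2 * L) := by
    unfold gain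
    refine mul_le_mul_of_nonneg_right ?_ (by positivity)
    refine Real.rpow_le_rpow_of_nonpos hA hAB ?_
    have : (1 : ℝ) ≤ p := by exact_mod_cast hp
    exact div_nonpos_of_nonpos_of_nonneg (by linarith) (by positivity)
  have h2 : gain p A L = √2 * gain p A (2 * L) := by
    rw [← gain_half p (by positivity)]; congr 1; ring
  have h3 : (4 / 3 : ℝ) ≤ √2 := Real.le_sqrt_of_sq_le (by norm_num)
  have := gain_nonneg p hA.le (show 0 ≤ 2 * L by positivity)
  nlinarith

/-- Growth of `A ^ (1 / (p + 1))` in a full step. -/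
theorem rpow_add_gain_le {p : ℕ} {A a L : ℝ} (hA : 0 ≤ A) (ha : 0 < a) (hL : 0 < L)
    (hroot : A + a = 2 * L * a ^ 2) :
    A ^ (1 / ((p : ℝ) + 1)) + 1 / (2 * ((p : ℝ) + 1)) * gain p (A + a) (L / 2)
      ≤ (A + a) ^ (1 / ((p : ℝ) + 1)) := by
  set B := A + a with hB
  have hBpos : 0 < B := by positivity
  set σ := 1 / ((p : ℝ) + 1) with hσ
  have hσ0 : 0 ≤ σ := by positivity
  have hσ1 : σ ≤ 1 := by
    rw [hσ, div_le_one (by positivity)]; linarith [(Nat.cast_nonneg p : (0 : ℝ) ≤ p)]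
  -- Bernoulli for A = B(1 - a/B) gives A^σ ≤ B^σ(1 - σa/B), and the root equation fixes a/B =
  -- (2LB)^(-1/2).
  have hbern := rpow_one_add_le_one_add_mul_self (s := -(a / B)) (p := σ)
    (by rw [neg_le_neg_iff, div_le_one hBpos]; linarith) hσ0 hσ1
  have hAB : A = B * (1 + -(a / B)) := by field_simp; rw [hB]; ring
  have hAs : A ^ σ ≤ B ^ σ * (1 + σ * -(a / B)) := by
    calc A ^ σ = B ^ σ * (1 + -(a / B)) ^ σ := by
          conv_lhs => rw [hAB]
          refine Real.mul_rpow hBpos.le ?_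
          have : a / B ≤ 1 := by rw [div_le_one hBpos]; linarith
          linarith
      _ ≤ _ := by gcongr
  have haB : a / B = (2 * L * B) ^ (-(1 / 2) : ℝ) := by
    have : 2 * L * B = (B / a) ^ 2 := by
      rw [div_pow, eq_div_iff (by positivity)]
      calc 2 * L * B * a ^ 2 = B * (2 * L * a ^ 2) := by ring
        _ = B ^ 2 := by rw [← hroot]; ring
    rw [this, Real.rpow_neg (by positivity), ← Real.sqrt_eq_rpow, Real.sqrt_sq (by positivity),
      inv_div]
  have hgain : gain p B (L / 2) = 2 * (B ^ σ * (a / B)) := by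
    rw [gain_half p hL, haB, Real.mul_rpow (by positivity) hBpos.le,
      Real.mul_rpow (by norm_num) hL.le, gain]
    have e1 : -((p : ℝ) - 1) / (2 * (p + 1)) = σ + -(1 / 2) := by
      rw [hσ]; field_simp; ring
    rw [e1, Real.rpow_add hBpos, Real.rpow_neg (by norm_num : (0 : ℝ) ≤ 2), ← Real.sqrt_eq_rpow]
    have : √2 = 2 * (√2)⁻¹ := by
      rw [eq_mul_inv_iff_mul_eq₀ (by positivity)]; exact Real.mul_self_sqrt (by norm_num)
    conv_lhs => rw [this]
    ring
  rw [hgain]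
  have e2 : 1 / (2 * ((p : ℝ) + 1)) = σ / 2 := by rw [hσ]; field_simp
  rw [e2]
  linarith

/-- A step whose proximal weight was underestimated is paid for by the distance it covers. -/
theorem rpow_le_gain {p : ℕ} (hp : 1 ≤ p) {A a L γ r : ℝ} (hA : 0 < A) (ha : 0 ≤ a) (hL : 0 < L)
    (hγ : 0 < γ) (hr : 0 < r) (hLr : L ≤ γ * r ^ (p - 1)) :
    γ ^ (-(1 / ((p : ℝ) + 1))) * ((A + a) * L * r ^ 2) ^ (-((p : ℝ) - 1) / (2 * (p + 1)))
      ≤ gain p A L := by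
  have hp' : (1 : ℝ) ≤ p := by exact_mod_cast hp
  set σ := 1 / ((p : ℝ) + 1) with hσ
  set b := -((p : ℝ) - 1) / (2 * (p + 1)) with hb
  have hb0 : b ≤ 0 := div_nonpos_of_nonpos_of_nonneg (by linarith) (by positivity)
  have h1 : ((A + a) * L * r ^ 2) ^ b ≤ (A * L * r ^ 2) ^ b :=
    Real.rpow_le_rpow_of_nonpos (by positivity) (by gcongr; linarith) hb0
  have h2 : (γ * r ^ (p - 1)) ^ (-σ) ≤ L ^ (-σ) :=
    Real.rpow_le_rpow_of_nonpos hL hLr (by rw [hσ, neg_nonpos]; positivity)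
  -- Since -1/2 = b - σ, the factor L^(-1/2) splits as L^b L^(-σ). Replacing L by γr^(p-1) in the
  -- second factor yields exactly the power (r²)^b.
  have h3 : (r ^ 2) ^ b = (r ^ (p - 1)) ^ (-σ) := by
    rw [← Real.rpow_natCast, ← Real.rpow_natCast, ← Real.rpow_mul hr.le, ← Real.rpow_mul hr.le]
    congr 1
    rw [Nat.cast_sub hp, hb, hσ]; push_cast; field_simp
  calc γ ^ (-σ) * ((A + a) * L * r ^ 2) ^ b
      ≤ γ ^ (-σ) * (A * L * r ^ 2) ^ b := by gcongr
    _ = A ^ b * L ^ b * (γ * r ^ (p - 1)) ^ (-σ) := by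
        rw [Real.mul_rpow (by positivity) (by positivity), Real.mul_rpow hA.le hL.le, h3,
          Real.mul_rpow hγ.le (by positivity)]
        ring
    _ ≤ A ^ b * L ^ b * L ^ (-σ) := by gcongr
    _ = gain p A L := by
        rw [gain, mul_assoc, ← Real.rpow_add hL]
        congr 2
        rw [hb, hσ]; field_simp; ring

/-! ### Growth of the weights `A` in the search-free scheme. -/

/-- The scalar quantities of `n` iterations started at `A 0 = 0`: the guessed weights `L`, the trial
steps `a`, the weights `A` and the distances `r` covered by the proximal steps. -/
structure IsSearchFreeSeq (p : ℕ) (γ : ℝ) (n : ℕ) (A L a r : ℕ → ℝ) : Prop where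
  A_zero : A 0 = 0
  L_zero : L 0 = γ * r 0 ^ (p - 1)
  a_pos : ∀ t < n, 0 < a t
  r_pos : ∀ t < n, 0 < r t
  root : ∀ t < n, A t + a t = 2 * L t * a t ^ 2
  down : ∀ t < n, γ * r t ^ (p - 1) ≤ L t → A (t + 1) = A t + a t ∧ L (t + 1) = L t / 2
  up : ∀ t < n, L t < γ * r t ^ (p - 1) → A t ≤ A (t + 1) ∧ L (t + 1) = 2 * L t

/-- The iterations before `t` in which the proximal weight was underestimated. -/
def upSteps (p : ℕ) (γ : ℝ) (L r : ℕ → ℝ) (t : ℕ) : Finset ℕ :=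
  open Classical in (Finset.range t).filter fun s => L s < γ * r s ^ (p - 1)

theorem upSteps_succ_of_up {p : ℕ} {γ : ℝ} {L r : ℕ → ℝ} {t : ℕ} (h : L t < γ * r t ^ (p - 1)) :
    upSteps p γ L r (t + 1) = insert t (upSteps p γ L r t) := by
  rw [upSteps, Finset.range_add_one, Finset.filter_insert, if_pos h, upSteps]

theorem upSteps_succ_of_down {p : ℕ} {γ : ℝ} {L r : ℕ → ℝ} {t : ℕ} (h : γ * r t ^ (p - 1) ≤ L t) :
    upSteps p γ L r (t + 1) = upSteps p γ L r t := by
  rw [upSteps, Finset.range_add_one, Finset.filter_insert, if_neg h.not_gt, upSteps]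

theorem notMem_upSteps_self (p : ℕ) (γ : ℝ) (L r : ℕ → ℝ) (t : ℕ) : t ∉ upSteps p γ L r t := by
  simp [upSteps]

theorem mem_upSteps {p : ℕ} {γ : ℝ} {L r : ℕ → ℝ} {t s : ℕ} :
    s ∈ upSteps p γ L r t ↔ s < t ∧ L s < γ * r s ^ (p - 1) := by
  simp [upSteps]

theorem half_le_root_mul {A a L : ℝ} (hA : 0 ≤ A) (ha : 0 < a) (hroot : A + a = 2 * L * a ^ 2) :
    1 / 2 ≤ (A + a) * L := by
  have h1 : 1 ≤ 2 * L * a := by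
    refine le_of_mul_le_mul_right ?_ ha
    nlinarith
  rw [hroot]
  nlinarith

/-- The squared distances weighted by the size of the steps, a quantity that the Lyapunov argument
bounds. -/
def movement (p : ℕ) (γ : ℝ) (A L a r : ℕ → ℝ) (t : ℕ) : ℝ :=
  (A t + a t) * min (γ * r t ^ (p - 1)) (L t) * r t ^ 2

namespace IsSearchFreeSeq

variable {p : ℕ} {γ : ℝ} {n : ℕ} {A L a r : ℕ → ℝ}

theorem L_pos_and_A_nonneg (hs : IsSearchFreeSeq p γ n A L a r) (hγ : 0 < γ) (hn : 1 ≤ n) :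
    ∀ t ≤ n, 0 < L t ∧ 0 ≤ A t := by
  intro t
  induction t with
  | zero =>
    intro _
    have := hs.r_pos 0 hn
    rw [hs.L_zero, hs.A_zero]
    exact ⟨by positivity, le_rfl⟩
  | succ t ih =>
    intro ht
    obtain ⟨h1, h2⟩ := ih (by omega)
    have ha := hs.a_pos t (by omega)
    rcases le_or_gt (γ * r t ^ (p - 1)) (L t) with h | h
    · obtain ⟨e1, e2⟩ := hs.down t (by omega) h
      rw [e1, e2]; exact ⟨by positivity, by positivity⟩
    · obtain ⟨e1, e2⟩ := hs.up t (by omega) h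
      rw [e2]; exact ⟨by positivity, h2.trans e1⟩

/-- A down step ends with A L equal to half of (A + a)L ≥ 1/2, and an up step at least doubles A L.
The first step is always down, because `L 0` is the true weight. -/
theorem quarter_le_A_mul_L (hs : IsSearchFreeSeq p γ n A L a r) (hγ : 0 < γ) :
    ∀ t < n, 1 / 4 ≤ A (t + 1) * L (t + 1) := by
  intro t ht
  obtain ⟨hL, hA⟩ := hs.L_pos_and_A_nonneg hγ (by omega) t ht.le
  have hdown : γ * r t ^ (p - 1) ≤ L t → 1 / 4 ≤ A (t + 1) * L (t + 1) := by
    intro h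
    obtain ⟨e1, e2⟩ := hs.down t ht h
    have := half_le_root_mul hA (hs.a_pos t ht) (hs.root t ht)
    rw [e1, e2]; linarith
  induction t with
  | zero => exact hdown hs.L_zero.ge
  | succ t ih =>
    obtain ⟨hL', hA'⟩ := hs.L_pos_and_A_nonneg hγ (by omega) t (by omega)
    rcases le_or_gt (γ * r (t + 1) ^ (p - 1)) (L (t + 1)) with h | h
    · exact hdown h
    · obtain ⟨e1, e2⟩ := hs.up (t + 1) ht h
      have hprev : 1 / 4 ≤ A (t + 1) * L (t + 1) := by
        refine ih (by omega) hL' hA' fun h' => ?_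
        obtain ⟨d1, d2⟩ := hs.down t (by omega) h'
        have := half_le_root_mul hA' (hs.a_pos t (by omega)) (hs.root t (by omega))
        rw [d1, d2]; linarith
      rw [e2]
      nlinarith [mul_le_mul_of_nonneg_right e1 hL.le]

theorem A_pos (hs : IsSearchFreeSeq p γ n A L a r) (hγ : 0 < γ) {t : ℕ} (ht : t < n) :
    0 < A (t + 1) := by
  obtain ⟨h1, h2⟩ := hs.L_pos_and_A_nonneg hγ (by omega) (t + 1) ht
  have := hs.quarter_le_A_mul_L hγ t ht
  exact pos_of_mul_pos_left (by linarith) h1.le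

/-- The product L t * 2 ^ t is unchanged by a halving and multiplied by 4 by a doubling. -/
theorem L_mul_two_pow (hs : IsSearchFreeSeq p γ n A L a r) :
    ∀ t ≤ n, L t * 2 ^ t = L 0 * 4 ^ (upSteps p γ L r t).card := by
  intro t
  induction t with
  | zero => intro _; simp [upSteps]
  | succ t ih =>
    intro ht
    have ih := ih (by omega)
    rcases le_or_gt (γ * r t ^ (p - 1)) (L t) with h | h
    · rw [(hs.down t (by omega) h).2, upSteps_succ_of_down h, ← ih]; ring
    · rw [(hs.up t (by omega) h).2, upSteps_succ_of_up h,
        Finset.card_insert_of_notMem (notMem_upSteps_self p γ L r t), pow_succ 4, ← mul_assoc, ← ih]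
      ring

/-- The right-hand side is a potential. In a down step the growth of A^(1/(p+1)) pays for the new
`gain`. In an up step `gain` loses at least a quarter of its value, which pays for the summand
1/(8(p+1)) times the old `gain`. -/
theorem sum_gain_le (hs : IsSearchFreeSeq p γ n A L a r) (hp : 1 ≤ p) (hγ : 0 < γ) :
    ∀ t < n, 1 / (8 * ((p : ℝ) + 1)) * ∑ s ∈ upSteps p γ L r (t + 1), gain p (A s) (L s)
      ≤ A (t + 1) ^ (1 / ((p : ℝ) + 1))
        - 1 / (2 * ((p : ℝ) + 1)) * gain p (A (t + 1)) (L (t + 1)) := by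
  intro t
  induction t with
  | zero =>
    intro ht
    have h := hs.L_zero.ge
    obtain ⟨hL, hA⟩ := hs.L_pos_and_A_nonneg hγ (by omega) 0 (by omega)
    have hg := rpow_add_gain_le (p := p) hA (hs.a_pos 0 ht) hL (hs.root 0 ht)
    obtain ⟨e1, e2⟩ := hs.down 0 ht h
    rw [upSteps_succ_of_down h, e1, e2]
    simp only [upSteps, Finset.range_zero, Finset.filter_empty, Finset.sum_empty, mul_zero]
    have : 0 ≤ A 0 ^ (1 / ((p : ℝ) + 1)) := by positivity
    linarith
  | succ t ih =>
    intro ht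
    have ih := ih (by omega)
    obtain ⟨hL, hA⟩ := hs.L_pos_and_A_nonneg hγ (by omega) (t + 1) (by omega)
    have hg0 := gain_nonneg p hA hL.le
    have hc : 0 < 1 / (2 * ((p : ℝ) + 1)) := by positivity
    rcases le_or_gt (γ * r (t + 1) ^ (p - 1)) (L (t + 1)) with h | h
    · have hg := rpow_add_gain_le (p := p) hA (hs.a_pos (t + 1) ht) hL (hs.root (t + 1) ht)
      obtain ⟨e1, e2⟩ := hs.down (t + 1) ht h
      rw [upSteps_succ_of_down h, e1, e2]
      have := mul_nonneg hc.le hg0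
      linarith
    · obtain ⟨e1, e2⟩ := hs.up (t + 1) ht h
      have hApos := hs.A_pos hγ (t := t) (by omega)
      have hg := gain_double_le hp hApos e1 hL
      have hmono : A (t + 1) ^ (1 / ((p : ℝ) + 1)) ≤ A (t + 1 + 1) ^ (1 / ((p : ℝ) + 1)) :=
        Real.rpow_le_rpow hA e1 (by positivity)
      rw [upSteps_succ_of_up h, Finset.sum_insert (notMem_upSteps_self p γ L r (t + 1)), e2,
        mul_add]
      have e8 : 1 / (8 * ((p : ℝ) + 1)) = 1 / (2 * ((p : ℝ) + 1)) / 4 := by field_simp; norm_num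
      have := mul_le_mul_of_nonneg_left hg hc.le
      have h8 : 1 / (8 * ((p : ℝ) + 1)) * gain p (A (t + 1)) (L (t + 1))
        = 1 / (2 * ((p : ℝ) + 1)) * gain p (A (t + 1)) (L (t + 1)) / 4 := by rw [e8]; ring
      linarith

theorem movement_pos (hs : IsSearchFreeSeq p γ n A L a r) (hγ : 0 < γ) {t : ℕ} (ht : t < n) :
    0 < movement p γ A L a r t := by
  obtain ⟨hL, hA⟩ := hs.L_pos_and_A_nonneg hγ (by omega) t ht.le
  have := hs.a_pos t ht
  have hr := hs.r_pos t ht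
  have : 0 < min (γ * r t ^ (p - 1)) (L t) := lt_min (by positivity) hL
  unfold movement; positivity

/-- The case of many doublings: movement at most ρ² over u up steps averages at most m = ρ²/u, so
the total `gain` is at least γ^(-σ) m^b u/2. The power 2(p+1) clears the fractional exponents,
leaving u^(2(p+1)) u^(p-1) = u^(3p+1). -/
theorem pow_card_upSteps_le (hs : IsSearchFreeSeq p γ n A L a r) (hp : 1 ≤ p) (hγ : 0 < γ)
    (hn : 1 ≤ n) {ρ : ℝ} (hρ : 0 < ρ)
    (hsum : ∑ t ∈ Finset.range n, movement p γ A L a r t ≤ ρ ^ 2)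
    (hu : 1 ≤ (upSteps p γ L r n).card) :
    (1 / (16 * ((p : ℝ) + 1))) ^ (2 * (p + 1)) * ((upSteps p γ L r n).card : ℝ) ^ (3 * p + 1)
      ≤ (A n * γ * ρ ^ (p - 1)) ^ 2 := by
  have hp' : (1 : ℝ) ≤ p := by exact_mod_cast hp
  set U := upSteps p γ L r n with hU
  set u : ℝ := (U.card : ℝ) with hudef
  have hu0 : 0 < u := by rw [hudef]; exact_mod_cast hu
  set b : ℝ := -((p : ℝ) - 1) / (2 * (p + 1)) with hb
  set σ := 1 / ((p : ℝ) + 1) with hσ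
  set m := ρ ^ 2 / u with hm
  have hm0 : 0 < m := by positivity
  obtain ⟨k, rfl⟩ : ∃ k, n = k + 1 := ⟨n - 1, by omega⟩
  obtain ⟨hLn, hAn⟩ := hs.L_pos_and_A_nonneg hγ hn (k + 1) le_rfl
  have hterm : ∀ s ∈ U, γ ^ (-σ) * m ^ b * (1 - movement p γ A L a r s / m / 2)
      ≤ gain p (A s) (L s) := by
    intro s hsU
    obtain ⟨hsn, hup⟩ := mem_upSteps.1 hsU
    have hs0 : s ≠ 0 := by
      rintro rfl; exact hup.ne hs.L_zero
    obtain ⟨j, rfl⟩ : ∃ j, s = j + 1 := ⟨s - 1, by omega⟩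
    have hA := hs.A_pos hγ (t := j) (by omega)
    have hL := (hs.L_pos_and_A_nonneg hγ hn (j + 1) hsn.le).1
    have hmov := hs.movement_pos hγ hsn
    have h1 := rpow_le_gain hp hA (hs.a_pos _ hsn).le hL hγ (hs.r_pos _ hsn) hup.le
    have e1 : (A (j + 1) + a (j + 1)) * L (j + 1) * r (j + 1) ^ 2
        = movement p γ A L a r (j + 1) := by rw [movement, min_eq_right hup.le]
    rw [e1] at h1
    refine le_trans ?_ h1
    have h2 := one_sub_half_le_rpow_neg (x := movement p γ A L a r (j + 1) / m) (s := -b)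
      (by positivity) (by rw [hb, neg_div, neg_neg]; exact div_nonneg (by linarith) (by positivity))
      (by rw [hb, neg_div, neg_neg, div_le_one (by positivity)]; linarith)
    rw [neg_neg] at h2
    calc _ ≤ γ ^ (-σ) * m ^ b * (movement p γ A L a r (j + 1) / m) ^ b := by gcongr
      _ = _ := by
        rw [mul_assoc, ← Real.mul_rpow hm0.le (by positivity), mul_div_cancel₀ _ hm0.ne']
  have hUsum : ∑ s ∈ U, movement p γ A L a r s ≤ ρ ^ 2 := by
    refine le_trans (Finset.sum_le_sum_of_subset_of_nonneg ?_ ?_) hsum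
    · intro s hsU; exact Finset.mem_range.2 (mem_upSteps.1 hsU).1
    · intro s hsr _; exact (hs.movement_pos hγ (Finset.mem_range.1 hsr)).le
  have hgainsum : γ ^ (-σ) * m ^ b * (u / 2) ≤ ∑ s ∈ U, gain p (A s) (L s) := by
    refine le_trans ?_ (Finset.sum_le_sum hterm)
    rw [← Finset.mul_sum, Finset.sum_sub_distrib, Finset.sum_const, nsmul_eq_mul, mul_one,
      ← Finset.sum_div, ← Finset.sum_div, ← hudef]
    have : (∑ s ∈ U, movement p γ A L a r s) / m ≤ u := by
      rw [div_le_iff₀ hm0, hm, mul_div_cancel₀ _ hu0.ne']; exact hUsum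
    gcongr
    linarith
  have hmain := hs.sum_gain_le hp hγ k (by omega)
  have hgn := mul_nonneg (show 0 ≤ 1 / (2 * ((p : ℝ) + 1)) by positivity) (gain_nonneg p hAn hLn.le)
  have hY : 1 / (16 * ((p : ℝ) + 1)) * (γ ^ (-σ) * m ^ b * u) ≤ A (k + 1) ^ σ := by
    have h1 := mul_le_mul_of_nonneg_left hgainsum (show 0 ≤ 1 / (8 * ((p : ℝ) + 1)) by positivity)
    have h2 : 1 / (8 * ((p : ℝ) + 1)) * (γ ^ (-σ) * m ^ b * (u / 2))
        = 1 / (16 * ((p : ℝ) + 1)) * (γ ^ (-σ) * m ^ b * u) := by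
      field_simp; norm_num
    linarith
  have hYpow := pow_le_pow_left₀ (by positivity) hY (2 * (p + 1))
  have r1 : (A (k + 1) ^ σ) ^ (2 * (p + 1)) = A (k + 1) ^ 2 := by
    rw [← Real.rpow_natCast, ← Real.rpow_mul hAn, ← Real.rpow_natCast]
    congr 1; rw [hσ]; push_cast; field_simp
  have r2 : (γ ^ (-σ)) ^ (2 * (p + 1)) * γ ^ 2 = 1 := by
    rw [← Real.rpow_natCast, ← Real.rpow_mul hγ.le, ← Real.rpow_natCast γ, ← Real.rpow_add hγ]
    rw [show -σ * ((2 * (p + 1) : ℕ) : ℝ) + ((2 : ℕ) : ℝ) = 0 by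
      rw [hσ]; push_cast; field_simp; ring, Real.rpow_zero]
  have r3 : (m ^ b) ^ (2 * (p + 1)) * (ρ ^ (p - 1)) ^ 2 = u ^ (p - 1) := by
    have e1 : (m ^ b) ^ (2 * (p + 1)) = (m ^ (p - 1))⁻¹ := by
      rw [← Real.rpow_natCast, ← Real.rpow_mul hm0.le, ← Real.rpow_natCast m,
        ← Real.rpow_neg hm0.le]
      congr 1; rw [hb, Nat.cast_sub hp]; push_cast; field_simp
    rw [e1, ← pow_mul, mul_comm (p - 1) 2, pow_mul, hm, div_pow, inv_div]
    field_simp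
  rw [r1] at hYpow
  have := mul_le_mul_of_nonneg_right hYpow (show 0 ≤ γ ^ 2 * (ρ ^ (p - 1)) ^ 2 by positivity)
  calc (1 / (16 * ((p : ℝ) + 1))) ^ (2 * (p + 1)) * u ^ (3 * p + 1)
      = (1 / (16 * ((p : ℝ) + 1)) * (γ ^ (-σ) * m ^ b * u)) ^ (2 * (p + 1))
          * (γ ^ 2 * (ρ ^ (p - 1)) ^ 2) := by
        rw [mul_pow, mul_pow, mul_pow]
        have e3 : u ^ (3 * p + 1) = u ^ (p - 1) * u ^ (2 * (p + 1)) := by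
          rw [← pow_add]; congr 1; omega
        rw [e3, ← r3]
        linear_combination (-(1 / (16 * ((p : ℝ) + 1))) ^ (2 * (p + 1)) * (m ^ b) ^ (2 * (p + 1))
          * (ρ ^ (p - 1)) ^ 2 * u ^ (2 * (p + 1))) * r2
    _ ≤ _ := this
    _ = _ := by ring

/-- The case of few doublings: `L n` is tiny compared with `L 0`, while A L ≥ 1/4. -/
theorem two_pow_le (hs : IsSearchFreeSeq p γ n A L a r) (hγ : 0 < γ)
    (hn : 1 ≤ n) {ρ : ℝ} (hρ : 0 < ρ)
    (hsum : ∑ t ∈ Finset.range n, movement p γ A L a r t ≤ ρ ^ 2) :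
    2 ^ n ≤ 4 * 2 ^ (p - 1) * 4 ^ (upSteps p γ L r n).card * (A n * γ * ρ ^ (p - 1)) := by
  obtain ⟨k, rfl⟩ : ∃ k, n = k + 1 := ⟨n - 1, by omega⟩
  have hAL := hs.quarter_le_A_mul_L hγ k (by omega)
  have hL := hs.L_mul_two_pow (k + 1) le_rfl
  have hA := hs.A_pos hγ (t := k) (by omega)
  have hr0 := hs.r_pos 0 (by omega)
  have hmov : movement p γ A L a r 0 ≤ ρ ^ 2 :=
    le_trans (Finset.single_le_sum (f := movement p γ A L a r)
      (fun t ht => (hs.movement_pos hγ (Finset.mem_range.1 ht)).le)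
      (Finset.mem_range.2 (by omega))) hsum
  have hhalf := half_le_root_mul hs.A_zero.ge (hs.a_pos 0 (by omega)) (hs.root 0 (by omega))
  -- The movement of the first step alone is at least r₀²/2.
  have hr : r 0 ≤ 2 * ρ := by
    rw [movement, min_eq_right hs.L_zero.le] at hmov
    refine le_of_sq_le_sq ?_ (by positivity)
    nlinarith [mul_le_mul_of_nonneg_right hhalf (sq_nonneg (r 0)), sq_nonneg ρ]
  have hL0 : L 0 ≤ γ * (2 ^ (p - 1) * ρ ^ (p - 1)) := by
    rw [hs.L_zero, ← mul_pow]; gcongr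
  calc (2 : ℝ) ^ (k + 1) ≤ 4 * (A (k + 1) * L (k + 1)) * 2 ^ (k + 1) :=
        le_mul_of_one_le_left (by positivity) (by linarith)
    _ = 4 * A (k + 1) * (L 0 * 4 ^ (upSteps p γ L r (k + 1)).card) := by rw [← hL]; ring
    _ ≤ 4 * A (k + 1) * (γ * (2 ^ (p - 1) * ρ ^ (p - 1)) * 4 ^ (upSteps p γ L r (k + 1)).card) := by
        gcongr
    _ = _ := by ring

end IsSearchFreeSeq

theorem pow_le_factorial_mul_two_pow (N n : ℕ) :
    (n : ℝ) ^ N ≤ 2 ^ N * N.factorial * 2 ^ n := by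
  have h1 := Real.pow_div_factorial_le_exp ((n : ℝ) * Real.log 2) (by positivity) N
  rw [mul_comm (n : ℝ), Real.exp_mul, Real.exp_log (by norm_num), Real.rpow_natCast,
    div_le_iff₀ (by positivity)] at h1
  have h2 : (1 / 2 * (n : ℝ)) ^ N ≤ (Real.log 2 * n) ^ N := by
    gcongr; linarith [Real.log_two_gt_d9]
  calc (n : ℝ) ^ N = 2 ^ N * (1 / 2 * (n : ℝ)) ^ N := by rw [← mul_pow]; congr 1; ring
    _ ≤ 2 ^ N * (2 ^ n * N.factorial) := by gcongr; exact h2.trans h1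
    _ = _ := by ring

/-- The growth of the weights `A` in terms of the movement. -/
theorem exists_pow_le_of_movement_le {p : ℕ} (hp : 1 ≤ p) :
    ∃ c > (0 : ℝ), ∀ (γ ρ : ℝ) (n : ℕ) (A L a r : ℕ → ℝ), 0 < γ → 0 < ρ → 1 ≤ n →
      IsSearchFreeSeq p γ n A L a r →
      ∑ t ∈ Finset.range n, movement p γ A L a r t ≤ ρ ^ 2 →
      c * (n : ℝ) ^ (3 * p + 1) ≤ (A n * γ * ρ ^ (p - 1)) ^ 2 := by
  set N := 3 * p + 1 with hN
  set c₁ : ℝ := (1 / (16 * ((p : ℝ) + 1))) ^ (2 * (p + 1)) / 4 ^ N with hc₁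
  set c₂ : ℝ := 1 / ((4 * 2 ^ (p - 1)) ^ 2 * (2 ^ N * N.factorial)) with hc₂
  have hc₁0 : 0 < c₁ := by positivity
  have hc₂0 : 0 < c₂ := by positivity
  refine ⟨min c₁ c₂, lt_min hc₁0 hc₂0, fun γ ρ n A L a r hγ hρ hn hs hsum => ?_⟩
  set u := (upSteps p γ L r n).card with hu
  -- For 4u ≤ n the factor (4^u)² is at most 2^n, so squaring the exponential bound still leaves one
  -- factor 2^n.
  rcases le_or_gt (4 * u) n with h | h
  · have h1 := hs.two_pow_le hγ hn hρ hsum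
    set X := A n * γ * ρ ^ (p - 1)
    have h2 : (2 : ℝ) ^ n ≤ (4 * 2 ^ (p - 1)) ^ 2 * X ^ 2 := by
      have h3 := pow_le_pow_left₀ (by positivity) h1 2
      have h4 : ((4 : ℝ) ^ u) ^ 2 ≤ 2 ^ n := by
        rw [show (4 : ℝ) = 2 ^ 2 by norm_num, ← pow_mul, ← pow_mul]
        exact pow_le_pow_right₀ (by norm_num) (by omega)
      have h5 : (2 : ℝ) ^ n * 2 ^ n ≤ (4 * 2 ^ (p - 1)) ^ 2 * X ^ 2 * 2 ^ n := by
        calc (2 : ℝ) ^ n * 2 ^ n = (2 ^ n) ^ 2 := by ring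
          _ ≤ (4 * 2 ^ (p - 1) * 4 ^ u * X) ^ 2 := h3
          _ = (4 * 2 ^ (p - 1)) ^ 2 * X ^ 2 * (4 ^ u) ^ 2 := by ring
          _ ≤ _ := by gcongr
      exact le_of_mul_le_mul_right h5 (by positivity)
    calc min c₁ c₂ * (n : ℝ) ^ N ≤ c₂ * (2 ^ N * N.factorial * 2 ^ n) := by
          gcongr
          · exact min_le_right _ _
          · exact pow_le_factorial_mul_two_pow N n
      _ ≤ c₂ * (2 ^ N * N.factorial * ((4 * 2 ^ (p - 1)) ^ 2 * X ^ 2)) := by gcongr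
      _ = X ^ 2 := by rw [hc₂]; field_simp
  · have h1 := hs.pow_card_upSteps_le hp hγ hn hρ hsum (by omega)
    refine le_trans ?_ h1
    have h2 : (n : ℝ) ≤ 4 * u := by exact_mod_cast h.le
    calc min c₁ c₂ * (n : ℝ) ^ N ≤ c₁ * (4 * u) ^ N := by
          gcongr
          exact min_le_left _ _
      _ = _ := by rw [hc₁, mul_pow, ← hu, ← hN]; field_simp

/-! ### Proximal inequalities, uniform convexity and projection. -/

variable {E : Type*} [NormedAddCommGroup E] [InnerProductSpace ℝ E]

/-- A long step absorbs δ: the residual is at most (3/4)λ‖d‖. Expanding its square gives 7/16 = 1 -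
9/16. -/
theorem inner_le_of_prox {G d : E} {lam δ : ℝ}
    (hprox : ‖G + lam • d‖ ≤ lam / 2 * ‖d‖ + δ) (hlarge : 4 * δ < lam * ‖d‖) :
    2 * (lam * inner ℝ G d) ≤ -‖G‖ ^ 2 - 7 / 16 * (lam * ‖d‖) ^ 2 := by
  have h1 : ‖G + lam • d‖ ^ 2 = ‖G‖ ^ 2 + 2 * (lam * inner ℝ G d) + (lam * ‖d‖) ^ 2 := by
    rw [norm_add_sq_real, inner_smul_right, norm_smul, mul_pow, mul_pow, Real.norm_eq_abs, sq_abs]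
  have h2 : ‖G + lam • d‖ ^ 2 ≤ (3 / 4 * (lam * ‖d‖)) ^ 2 :=
    pow_le_pow_left₀ (norm_nonneg _) (by linarith) 2
  nlinarith

theorem norm_le_of_prox {G d : E} {lam δ : ℝ} (hlam : 0 ≤ lam)
    (hprox : ‖G + lam • d‖ ≤ lam / 2 * ‖d‖ + δ) (hsmall : lam * ‖d‖ ≤ 4 * δ) :
    ‖G‖ ≤ 7 * δ := by
  have h1 : ‖G‖ ≤ ‖G + lam • d‖ + ‖lam • d‖ := by
    simpa using norm_sub_le (G + lam • d) (lam • d)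
  rw [norm_smul, Real.norm_of_nonneg hlam] at h1
  linarith

section Convexity

variable {q : ℕ} {μ : ℝ} {Z : Set E} {h : E → ℝ} {grad : E → E}

theorem UniformlyConvexOn.sub_le_inner (hh : UniformlyConvexOn q μ Z h grad) (hμ : 0 ≤ μ) {z w : E}
    (hz : z ∈ Z) (hw : w ∈ Z) : h z - h w ≤ inner ℝ (grad z) (z - w) := by
  have h1 := hh w hw z hz
  have h2 : 0 ≤ μ / q * ‖w - z‖ ^ q := by positivity
  rw [← neg_sub z w, inner_neg_right, neg_sub] at h1
  linarith

theorem UniformlyConvexOn.sub_le_inner_add (hh : UniformlyConvexOn q μ Z h grad) (hμ : 0 ≤ μ)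
    {z w u : E} (hz : z ∈ Z) (hw : w ∈ Z) (hu : u ∈ normalCone Z z) :
    h z - h w ≤ inner ℝ (grad z + u) (z - w) := by
  have h1 := hh.sub_le_inner hμ hz hw
  have h2 := hu w hw
  rw [← neg_sub z w, inner_neg_right] at h2
  rw [inner_add_left]
  linarith

theorem UniformlyConvexOn.map_combo_le (hh : UniformlyConvexOn q μ Z h grad) (hμ : 0 ≤ μ)
    (hZ : Convex ℝ Z) {x y : E} (hx : x ∈ Z) (hy : y ∈ Z) {a b : ℝ} (ha : 0 ≤ a) (hb : 0 ≤ b)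
    (hab : a + b = 1) : h (a • x + b • y) ≤ a * h x + b * h y := by
  have hw := hZ hx hy ha hb hab
  have h1 := hh.sub_le_inner hμ hw hx
  have h2 := hh.sub_le_inner hμ hw hy
  set w := a • x + b • y with hwdef
  have h3 : a * inner ℝ (grad w) (w - x) + b * inner ℝ (grad w) (w - y) = 0 := by
    rw [← inner_smul_right, ← inner_smul_right, ← inner_add_right]
    have : a • (w - x) + b • (w - y) = (a + b) • w - w := by rw [hwdef]; module
    rw [this, hab, one_smul, sub_self, inner_zero_right]
  have h4 : h w = a * h w + b * h w := by rw [← add_mul, hab, one_mul]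
  nlinarith

/-- At the minimizer the gradient is nonnegative in feasible directions, so the linear term can be
dropped. -/
theorem UniformlyConvexOn.norm_pow_le [CompleteSpace E] (hh : UniformlyConvexOn q μ Z h grad)
    (hZ : Convex ℝ Z) {zstar z : E} (hs : zstar ∈ Z) (hz : z ∈ Z)
    (hgrad : HasGradientWithinAt h (grad zstar) Z zstar) (hmin : IsMinOn h Z zstar) :
    μ / q * ‖z - zstar‖ ^ q ≤ h z - h zstar := by
  have h1 := hh z hz zstar hs
  have h2 := hmin.localize.hasFDerivWithinAt_nonneg hgrad.hasFDerivWithinAt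
    (sub_mem_posTangentConeAt_of_segment_subset (hZ.segment_subset hs hz))
  simp only [InnerProductSpace.toDual_apply_apply] at h2
  linarith

end Convexity

theorem norm_proj_sub_le {Z : Set E} (hZ : IsCompact Z) (hc : Convex ℝ Z) {w : E} (hw : w ∈ Z)
    (y : E) : ‖proj Z y - w‖ ≤ ‖y - w‖ := by
  obtain ⟨hmem, hle⟩ := proj_spec hZ ⟨w, hw⟩ y
  set P := proj Z y
  have hinner : inner ℝ (y - P) (w - P) ≤ 0 := by
    have hiff := norm_eq_iInf_iff_real_inner_le_zero hc (u := y) hmem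
    refine hiff.1 (le_antisymm ?_ ?_) w hw
    · have : Nonempty Z := ⟨⟨w, hw⟩⟩
      exact le_ciInf fun w' => hle w' w'.2
    · exact ciInf_le ⟨0, by rintro _ ⟨x, rfl⟩; exact norm_nonneg _⟩ (⟨P, hmem⟩ : Z)
  have h1 : ‖y - w‖ ^ 2 = ‖y - P‖ ^ 2 - 2 * inner ℝ (y - P) (w - P) + ‖P - w‖ ^ 2 := by
    rw [← sub_sub_sub_cancel_right y w P, norm_sub_sq_real, norm_sub_rev w P]
  refine le_of_sq_le_sq ?_ (norm_nonneg _)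
  nlinarith [sq_nonneg ‖y - P‖]

/-! ### One iteration and its Lyapunov decrease. -/

/-- The centre of the proximal step taken from the state `x`. -/
def center (x : State E) : E :=
  (x.A / (x.A + stepRoot x.A x.lamP)) • x.z
    + (stepRoot x.A x.lamP / (x.A + stepRoot x.A x.lamP)) • x.v

/-- The distance covered by the proximal step taken from the state `x`. -/
def stepDist (iProx : E → E × E) (x : State E) : ℝ := ‖(iProx (center x)).1 - center x‖

/-- The Lyapunov function of the accelerated method. -/
def lyapunov (h : E → ℝ) (zstar : E) (x : State E) : ℝ :=
  x.A * (h x.z - h zstar) + ‖x.v - zstar‖ ^ 2 / 2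

/-- The states reached by the algorithm. -/
structure State.IsValid (Z : Set E) (x : State E) : Prop where
  z_mem : x.z ∈ Z
  zt_mem : x.zt ∈ Z
  v_mem : x.v ∈ Z
  A_nonneg : 0 ≤ x.A
  lamP_pos : 0 < x.lamP

section Step

variable {p : ℕ} {γ δ μ : ℝ} {Z : Set E} {h : E → ℝ} {grad iGrad : E → E} {iProx : E → E × E}
  {x : State E} {zstar : E}

theorem stepRoot_spec (hx : x.IsValid Z) :
    0 < stepRoot x.A x.lamP ∧
      x.A + stepRoot x.A x.lamP = 2 * x.lamP * stepRoot x.A x.lamP ^ 2 :=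
  (stepRoot_iff hx.A_nonneg hx.lamP_pos _).2 rfl

theorem center_mem (hc : Convex ℝ Z) (hx : x.IsValid Z) : center x ∈ Z := by
  have ha := (stepRoot_spec hx).1
  have hA := hx.A_nonneg
  exact hc hx.z_mem hx.v_mem (by positivity) (by positivity) (by field_simp)

theorem step_of_le (hle : γ * stepDist iProx x ^ (p - 1) ≤ x.lamP) :
    (step p γ Z iGrad iProx x).A = x.A + stepRoot x.A x.lamP ∧
      (step p γ Z iGrad iProx x).lamP = x.lamP / 2 := by
  have hle' : proxWeight p γ (iProx (center x)).1 (center x) ≤ x.lamP := hle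
  constructor
  · change x.A + (if proxWeight p γ (iProx (center x)).1 (center x) ≤ x.lamP then 1
      else _) * stepRoot x.A x.lamP = _
    rw [if_pos hle', one_mul]
  · change (if proxWeight p γ (iProx (center x)).1 (center x) ≤ x.lamP then _ else _) = _
    rw [if_pos hle']

theorem step_of_lt (hx : x.IsValid Z) (hlt : x.lamP < γ * stepDist iProx x ^ (p - 1)) :
    x.A ≤ (step p γ Z iGrad iProx x).A ∧ (step p γ Z iGrad iProx x).lamP = 2 * x.lamP := by
  have hlt' : ¬ proxWeight p γ (iProx (center x)).1 (center x) ≤ x.lamP := not_le.2 hlt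
  constructor
  · change _ ≤ x.A + (if proxWeight p γ (iProx (center x)).1 (center x) ≤ x.lamP then 1
      else x.lamP / proxWeight p γ (iProx (center x)).1 (center x)) * stepRoot x.A x.lamP
    rw [if_neg hlt']
    have h1 := (stepRoot_spec hx).1
    have h2 := hx.lamP_pos
    have h3 : 0 < proxWeight p γ (iProx (center x)).1 (center x) := h2.trans hlt
    have : 0 ≤ x.lamP / proxWeight p γ (iProx (center x)).1 (center x) * stepRoot x.A x.lamP := by
      positivity
    linarith
  · change (if proxWeight p γ (iProx (center x)).1 (center x) ≤ x.lamP then _ else _) = _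
    rw [if_neg hlt']

/-- One iteration in terms of the damping factor `θ`. -/
theorem exists_damping (hx : x.IsValid Z) :
    ∃ θ : ℝ, 0 < θ ∧ θ ≤ 1 ∧
      θ * (γ * stepDist iProx x ^ (p - 1)) = min (γ * stepDist iProx x ^ (p - 1)) x.lamP ∧
      (step p γ Z iGrad iProx x).A = x.A + θ * stepRoot x.A x.lamP ∧
      (step p γ Z iGrad iProx x).z =
        ((1 - θ) * x.A / (x.A + θ * stepRoot x.A x.lamP)) • x.z
          + (θ * (x.A + stepRoot x.A x.lamP) / (x.A + θ * stepRoot x.A x.lamP))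
            • (iProx (center x)).1 ∧
      (step p γ Z iGrad iProx x).v = proj Z (x.v - (θ * stepRoot x.A x.lamP) •
        (iGrad (iProx (center x)).1 + (iProx (center x)).2)) := by
  have hL := hx.lamP_pos
  set lam := γ * stepDist iProx x ^ (p - 1) with hlam
  refine ⟨if lam ≤ x.lamP then 1 else x.lamP / lam, ?_, ?_, ?_, rfl, rfl, rfl⟩
  · split_ifs with h
    · exact one_pos
    · have := hL.trans (not_le.1 h); positivity
  · split_ifs with h
    · exact le_rfl
    · have := not_le.1 h
      rw [div_le_one (hL.trans this)]; exact this.le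
  · split_ifs with h
    · rw [one_mul, min_eq_left h]
    · have := not_le.1 h
      rw [min_eq_right this.le, div_mul_cancel₀ _ (hL.trans this).ne']

theorem isValid_step (hZ : IsCompact Z) (hc : Convex ℝ Z) (hprox : IsProxOracle p Z grad δ γ iProx)
    (hx : x.IsValid Z) : (step p γ Z iGrad iProx x).IsValid Z := by
  obtain ⟨θ, hθ0, hθ1, -, eA, ez, ev⟩ :=
    exists_damping (p := p) (γ := γ) (iGrad := iGrad) (iProx := iProx) hx
  have hzt : (iProx (center x)).1 ∈ Z := (hprox _ (center_mem hc hx)).1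
  have ha := (stepRoot_spec hx).1
  have hA := hx.A_nonneg
  have hL := hx.lamP_pos
  have hθ1' : 0 ≤ 1 - θ := by linarith
  refine ⟨?_, hzt, ?_, ?_, ?_⟩
  · rw [ez]
    refine hc hx.z_mem hzt (by positivity) (by positivity) ?_
    field_simp; ring
  · rw [ev]; exact (proj_spec hZ ⟨_, hx.z_mem⟩ _).1
  · rw [eA]; positivity
  · rcases le_or_gt (γ * stepDist iProx x ^ (p - 1)) x.lamP with hle | hlt
    · rw [(step_of_le hle).2]; positivity
    · rw [(step_of_lt hx hlt).2]; positivity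

/-- A proximal step that is short compared with the oracle error ends near the minimum. -/
theorem sub_le_of_short_step (hZ : IsCompact Z) (hμ : 0 ≤ μ) (hγ : 0 ≤ γ)
    (hh : UniformlyConvexOn (p + 1) μ Z h grad) (hprox : IsProxOracle p Z grad δ γ iProx)
    (hstar : zstar ∈ Z) {zbar : E} (hzbar : zbar ∈ Z)
    (hshort : proxWeight p γ (iProx zbar).1 zbar * ‖(iProx zbar).1 - zbar‖ ≤ 4 * δ) :
    h (iProx zbar).1 - h zstar ≤ 7 * δ * Metric.diam Z := by
  obtain ⟨h1, h2, h3⟩ := hprox zbar hzbar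
  have hG := norm_le_of_prox (by unfold proxWeight; positivity) h3 hshort
  have hD : ‖(iProx zbar).1 - zstar‖ ≤ Metric.diam Z := by
    rw [← dist_eq_norm]; exact Metric.dist_le_diam_of_mem hZ.isBounded h1 hstar
  calc h (iProx zbar).1 - h zstar
      ≤ inner ℝ (grad (iProx zbar).1 + (iProx zbar).2) ((iProx zbar).1 - zstar) :=
        hh.sub_le_inner_add hμ h1 hstar h2
    _ ≤ ‖grad (iProx zbar).1 + (iProx zbar).2‖ * ‖(iProx zbar).1 - zstar‖ :=
        real_inner_le_norm _ _
    _ ≤ _ := by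
        have := (norm_nonneg _).trans hG
        gcongr

/-- The damping makes the guessed weight safe: θλ ≤ λ' turns the root equation into 2λ(θa)² ≤ θ(A +
a), so the proximal decrease pays for the squared gradient in the mirror step. -/
theorem lyapunov_step_le (hZ : IsCompact Z) (hc : Convex ℝ Z) (hμ : 0 ≤ μ) (hδ : 0 ≤ δ)
    (hh : UniformlyConvexOn (p + 1) μ Z h grad) (hgrad : IsFirstOrderOracle Z grad δ iGrad)
    (hprox : IsProxOracle p Z grad δ γ iProx) (hstar : zstar ∈ Z) (hx : x.IsValid Z)
    (hlong : 4 * δ < γ * stepDist iProx x ^ (p - 1) * stepDist iProx x) :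
    lyapunov h zstar (step p γ Z iGrad iProx x) ≤ lyapunov h zstar x
      + ((step p γ Z iGrad iProx x).A - x.A) * (δ * Metric.diam Z)
      - 3 / 16 * ((x.A + stepRoot x.A x.lamP)
          * min (γ * stepDist iProx x ^ (p - 1)) x.lamP * stepDist iProx x ^ 2) := by
  obtain ⟨θ, hθ0, hθ1, hmin, eA, ez, ev⟩ :=
    exists_damping (p := p) (γ := γ) (iGrad := iGrad) (iProx := iProx) hx
  obtain ⟨ha, hroot⟩ := stepRoot_spec hx
  obtain ⟨hzt, hu, hp⟩ := hprox _ (center_mem hc hx)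
  have hgr := hgrad _ hzt
  have hA := hx.A_nonneg
  have hL := hx.lamP_pos
  have hbar : (x.A + stepRoot x.A x.lamP) • center x = x.A • x.z + stepRoot x.A x.lamP • x.v := by
    rw [center, smul_add, smul_smul, smul_smul, mul_div_cancel₀ _ (by positivity),
      mul_div_cancel₀ _ (by positivity)]
  rw [lyapunov, lyapunov, ez, ev, eA, ← hmin]
  change ‖_ + (γ * stepDist iProx x ^ (p - 1)) • _‖
    ≤ γ * stepDist iProx x ^ (p - 1) / 2 * stepDist iProx x + δ at hp
  have hr : stepDist iProx x = ‖(iProx (center x)).1 - center x‖ := rfl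
  have hlamL : θ * (γ * stepDist iProx x ^ (p - 1)) ≤ x.lamP := hmin ▸ min_le_right _ _
  clear hmin ez ev eA
  have hr0 : 0 ≤ stepDist iProx x := norm_nonneg _
  generalize stepDist iProx x = r at *
  generalize stepRoot x.A x.lamP = a at *
  generalize center x = zbar at *
  generalize (iProx zbar).1 = zt at *
  generalize (iProx zbar).2 = u at *
  generalize γ * r ^ (p - 1) = lam at *
  have hlam : 0 < lam := pos_of_mul_pos_left (by linarith) hr0
  have hθ1' : 0 ≤ 1 - θ := by linarith
  set G := grad zt + u with hG
  set g := iGrad zt + u with hg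
  have hgG : ‖g - G‖ ≤ δ := by rw [hg, hG, add_sub_add_right_eq_sub]; exact hgr
  -- the function values
  have hconv := hh.map_combo_le hμ hc hx.z_mem hzt (a := (1 - θ) * x.A / (x.A + θ * a))
    (b := θ * (x.A + a) / (x.A + θ * a)) (by positivity) (by positivity) (by field_simp; ring)
  have hconv' : (x.A + θ * a) * h (((1 - θ) * x.A / (x.A + θ * a)) • x.z
        + (θ * (x.A + a) / (x.A + θ * a)) • zt)
      ≤ (1 - θ) * x.A * h x.z + θ * (x.A + a) * h zt :=
    (mul_le_mul_of_nonneg_left hconv (show 0 ≤ x.A + θ * a by positivity)).trans_eq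
      (by field_simp)
  have hf1 := hh.sub_le_inner_add hμ hzt hstar hu
  have hf2 := hh.sub_le_inner_add hμ hzt hx.z_mem hu
  rw [← hG] at hf1 hf2
  -- The coupling (A + a) z̄ = A z + a v separates a proximal term from a mirror term.
  have hvec : a * inner ℝ G (zt - zstar) + x.A * inner ℝ G (zt - x.z)
      = (x.A + a) * inner ℝ G (zt - zbar) + a * inner ℝ G (x.v - zstar) := by
    rw [← inner_smul_right, ← inner_smul_right, ← inner_smul_right, ← inner_smul_right,
      ← inner_add_right, ← inner_add_right, smul_sub (x.A + a), hbar]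
    congr 1; module
  have hvals : θ * (a * (h zt - h zstar) + x.A * (h zt - h x.z))
      ≤ θ * ((x.A + a) * inner ℝ G (zt - zbar) + a * inner ℝ G (x.v - zstar)) := by
    rw [← hvec]; gcongr
  -- the mirror step
  have hproj := norm_proj_sub_le hZ hc hstar (x.v - (θ * a) • g)
  have hproj2 := pow_le_pow_left₀ (norm_nonneg _) hproj 2
  have hexp : ‖x.v - (θ * a) • g - zstar‖ ^ 2 = ‖x.v - zstar‖ ^ 2
      - 2 * (θ * a) * inner ℝ g (x.v - zstar) + (θ * a) ^ 2 * ‖g‖ ^ 2 := by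
    rw [sub_right_comm, norm_sub_sq_real, inner_smul_right, norm_smul, mul_pow, Real.norm_eq_abs,
      sq_abs, real_inner_comm]
    ring
  have hD : ‖x.v - zstar‖ ≤ Metric.diam Z := by
    rw [← dist_eq_norm]; exact Metric.dist_le_diam_of_mem hZ.isBounded hx.v_mem hstar
  have herr : inner ℝ G (x.v - zstar) - inner ℝ g (x.v - zstar) ≤ δ * Metric.diam Z := by
    rw [← inner_sub_left]
    refine (real_inner_le_norm _ _).trans ?_
    rw [norm_sub_rev]
    gcongr
  have herr' := mul_le_mul_of_nonneg_left herr (show 0 ≤ θ * a by positivity)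
  have hgsq : ‖g‖ ^ 2 ≤ 2 * ‖G‖ ^ 2 + 2 * δ ^ 2 := by
    have h1 : ‖g‖ ≤ ‖G‖ + δ := by
      have := norm_add_le G (g - G)
      rw [add_sub_cancel] at this; linarith
    nlinarith [norm_nonneg g, sq_nonneg (‖G‖ - δ)]
  -- the proximal step
  have hin := inner_le_of_prox (hr ▸ hp) (hr ▸ hlong)
  rw [← hr] at hin
  have hδ2 : δ ^ 2 ≤ (lam * r) ^ 2 / 16 := by
    have := pow_le_pow_left₀ hδ (show δ ≤ lam * r / 4 by linarith) 2
    linarith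
  have hasq : 2 * lam * (θ * a) ^ 2 ≤ θ * (x.A + a) := by
    rw [hroot]
    have := mul_le_mul_of_nonneg_left hlamL (show 0 ≤ 2 * θ * a ^ 2 by positivity)
    linarith
  -- After multiplication by 2λ the ‖G‖² terms cancel; 7/16 - 1/16 = 3/8 remains, and halving it
  -- gives 3/16.
  have hkey : θ * (x.A + a) * inner ℝ G (zt - zbar) + (θ * a) ^ 2 * ‖g‖ ^ 2 / 2
      ≤ - (3 / 16 * ((x.A + a) * (θ * lam) * r ^ 2)) := by
    refine le_of_mul_le_mul_left ?_ (show 0 < 2 * lam by positivity)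
    have h1 : 2 * lam * ((θ * a) ^ 2 * ‖g‖ ^ 2 / 2)
        ≤ θ * (x.A + a) * (‖G‖ ^ 2 + (lam * r) ^ 2 / 16) := by
      calc 2 * lam * ((θ * a) ^ 2 * ‖g‖ ^ 2 / 2) = 2 * lam * (θ * a) ^ 2 * (‖g‖ ^ 2 / 2) := by ring
        _ ≤ θ * (x.A + a) * (‖G‖ ^ 2 + (lam * r) ^ 2 / 16) := by
          gcongr; linarith
    have h2 := mul_le_mul_of_nonneg_left hin (show 0 ≤ θ * (x.A + a) by positivity)
    linarith
  linarith

end Step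

/-! ### Progress of one epoch. -/

section Epoch

variable {p : ℕ} {γ δ μ ε c : ℝ} {Z : Set E} {h iFunc : E → ℝ} {grad iGrad : E → E}
  {iProx : E → E × E} {z0 z1 zstar : E} {T : ℕ}

theorem epochState_succ (p : ℕ) (γ : ℝ) (Z : Set E) (iGrad : E → E) (iProx : E → E × E) (z0 : E)
    (t : ℕ) : epochState p γ Z iGrad iProx z0 (t + 1)
      = step p γ Z iGrad iProx (epochState p γ Z iGrad iProx z0 t) :=
  Function.iterate_succ_apply' _ _ _

theorem isValid_epochState (hZ : IsCompact Z) (hc : Convex ℝ Z) (hγ : 0 ≤ γ)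
    (hprox : IsProxOracle p Z grad δ γ iProx) (hz0 : z0 ∈ Z) (hne : (init p γ iProx z0).lamP ≠ 0)
    (t : ℕ) : (epochState p γ Z iGrad iProx z0 t).IsValid Z := by
  induction t with
  | zero =>
    refine ⟨hz0, hz0, hz0, le_rfl, lt_of_le_of_ne ?_ (Ne.symm hne)⟩
    change 0 ≤ γ * ‖(iProx z0).1 - z0‖ ^ (p - 1)
    positivity
  | succ t ih => rw [epochState_succ]; exact isValid_step hZ hc hprox ih

theorem center_init (hx : (init p γ iProx z0).IsValid Z) : center (init p γ iProx z0) = z0 := by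
  have ha := (stepRoot_spec hx).1
  change (0 / (0 + stepRoot 0 (init p γ iProx z0).lamP)) • z0
    + (stepRoot 0 (init p γ iProx z0).lamP / (0 + stepRoot 0 (init p γ iProx z0).lamP)) • z0 = z0
  change 0 < stepRoot 0 (init p γ iProx z0).lamP at ha
  rw [zero_add, zero_div, div_self ha.ne', zero_smul, one_smul, zero_add]

/-- An epoch comes close to the minimum, through one of the points `z̃` or through its last `z`. -/
theorem exists_near_min [CompleteSpace E] (hp : 1 ≤ p) (hZ : IsCompact Z) (hc : Convex ℝ Z)
    (hμ : 0 < μ) (hγ : 0 < γ)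
    (hδ : 0 ≤ δ) (hdiff : HasGradientWithinAt h (grad zstar) Z zstar)
    (hh : UniformlyConvexOn (p + 1) μ Z h grad) (hgrad : IsFirstOrderOracle Z grad δ iGrad)
    (hprox : IsProxOracle p Z grad δ γ iProx) (hz0 : z0 ∈ Z) (hstar : zstar ∈ Z)
    (hmin : IsMinOn h Z zstar) (hne : (init p γ iProx z0).lamP ≠ 0) (hT : 1 ≤ T)
    (hgrowth : ∀ (γ ρ : ℝ) (n : ℕ) (A L a r : ℕ → ℝ), 0 < γ → 0 < ρ → 1 ≤ n →
      IsSearchFreeSeq p γ n A L a r →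
      ∑ t ∈ Finset.range n, movement p γ A L a r t ≤ ρ ^ 2 →
      c * (n : ℝ) ^ (3 * p + 1) ≤ (A n * γ * ρ ^ (p - 1)) ^ 2)
    (hcT : (3 ^ (p - 1) * (4 * (p + 1)) * (γ / μ)) ^ 2 ≤ c * (T : ℝ) ^ (3 * p + 1))
    (hpos : 0 < h z0 - h zstar) (hsmall : δ * Metric.diam Z ≤ (h z0 - h zstar) / 8) :
    (∃ t ≤ T, h (epochState p γ Z iGrad iProx z0 t).zt - h zstar ≤ 7 * δ * Metric.diam Z) ∨
      h (epochState p γ Z iGrad iProx z0 T).z - h zstar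
        ≤ (h z0 - h zstar) / 8 + δ * Metric.diam Z := by
  set x : ℕ → State E := epochState p γ Z iGrad iProx z0 with hxdef
  have hvalid : ∀ t, (x t).IsValid Z := isValid_epochState hZ hc hγ.le hprox hz0 hne
  have hsucc : ∀ t, x (t + 1) = step p γ Z iGrad iProx (x t) :=
    epochState_succ p γ Z iGrad iProx z0
  by_cases hlong : ∀ t < T, 4 * δ < γ * stepDist iProx (x t) ^ (p - 1) * stepDist iProx (x t)
  swap
  · push Not at hlong
    obtain ⟨t, ht, hshort⟩ := hlong
    refine Or.inl ⟨t + 1, ht, ?_⟩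
    rw [hsucc]
    exact sub_le_of_short_step hZ hμ.le hγ.le hh hprox hstar (center_mem hc (hvalid t)) hshort
  right
  set A : ℕ → ℝ := fun t => (x t).A with hA
  set L : ℕ → ℝ := fun t => (x t).lamP with hL
  set a : ℕ → ℝ := fun t => stepRoot (x t).A (x t).lamP with ha
  set r : ℕ → ℝ := fun t => stepDist iProx (x t) with hr
  set R := ‖z0 - zstar‖ with hR
  set e := h z0 - h zstar with he
  set D := Metric.diam Z
  have hseq : IsSearchFreeSeq p γ T A L a r := by
    refine ⟨rfl, ?_, fun t _ => (stepRoot_spec (hvalid t)).1, fun t ht => ?_,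
      fun t _ => (stepRoot_spec (hvalid t)).2, fun t _ hle => ?_, fun t _ hlt => ?_⟩
    · have hc0 : center (x 0) = z0 := center_init (hvalid 0)
      change γ * ‖(iProx z0).1 - z0‖ ^ (p - 1)
        = γ * ‖(iProx (center (x 0))).1 - center (x 0)‖ ^ (p - 1)
      rw [hc0]
    · refine lt_of_le_of_ne (norm_nonneg _) fun h0 => ?_
      have := hlong t ht
      change 4 * δ < γ * r t ^ (p - 1) * r t at this
      change 0 = r t at h0
      rw [← h0, mul_zero] at this
      linarith
    · have := step_of_le (Z := Z) (iGrad := iGrad) hle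
      rwa [← hsucc] at this
    · have := step_of_lt (iGrad := iGrad) (hvalid t) hlt
      rwa [← hsucc] at this
  have hlyap : ∀ t ≤ T, lyapunov h zstar (x t) ≤ R ^ 2 / 2 + A t * (δ * D)
      - 3 / 16 * ∑ s ∈ Finset.range t, movement p γ A L a r s := by
    intro t
    induction t with
    | zero =>
      intro _
      rw [Finset.sum_range_zero, lyapunov]
      change 0 * _ + ‖z0 - zstar‖ ^ 2 / 2 ≤ R ^ 2 / 2 + 0 * _ - _
      simp [hR]
    | succ t ih =>
      intro ht
      have ih := ih (by omega)
      have hst := lyapunov_step_le hZ hc hμ.le hδ hh hgrad hprox hstar (hvalid t)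
        (hlong t (by omega))
      rw [← hsucc] at hst
      rw [Finset.sum_range_succ, mul_add]
      change _ ≤ _ + (A (t + 1) - A t) * (δ * D) - 3 / 16 * movement p γ A L a r t at hst
      linarith
  have hfin := hlyap T le_rfl
  have hATnn : 0 ≤ A T := (hvalid T).A_nonneg
  have hvalT : 0 ≤ h (x T).z - h zstar := sub_nonneg.2 (hmin (hvalid T).z_mem)
  have hsum0 : 0 ≤ ∑ s ∈ Finset.range T, movement p γ A L a r s :=
    Finset.sum_nonneg fun s hs => (hseq.movement_pos hγ (Finset.mem_range.1 hs)).le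
  have hlow : A T * (h (x T).z - h zstar) ≤ lyapunov h zstar (x T) := by
    rw [lyapunov]; linarith [sq_nonneg ‖(x T).v - zstar‖]
  have hRpos : 0 < R := by
    rw [hR, norm_pos_iff, sub_ne_zero]
    rintro rfl
    simp [he] at hpos
  -- When A_T e ≥ 4R², the Lyapunov bound R²/2 is at most A_T e/8.
  rcases le_or_gt (4 * R ^ 2) (A T * e) with hbig | hlt
  · have hATpos : 0 < A T := pos_of_mul_pos_left (lt_of_lt_of_le (by positivity) hbig) hpos.le
    refine le_of_mul_le_mul_left ?_ hATpos
    linarith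
  · exfalso
    have h1 : A T * (δ * D) ≤ R ^ 2 / 2 := by
      have := mul_le_mul_of_nonneg_left hsmall hATnn
      linarith
    -- The movement is at most (16/3)(R²/2 + R²/2), and 16/3 ≤ 9.
    have h2 : ∑ s ∈ Finset.range T, movement p γ A L a r s ≤ (3 * R) ^ 2 := by
      have := mul_nonneg hATnn hvalT
      nlinarith [sq_nonneg R]
    have h3 := hgrowth γ (3 * R) T A L a r hγ (by positivity) hT hseq h2
    have huc := hh.norm_pow_le hc hstar hz0 hdiff hmin
    rw [← hR, ← he] at huc
    have h4 : A T * R ^ (p - 1) < 4 * (p + 1) / μ := by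
      have e1 : R ^ (p + 1) = R ^ (p - 1) * R ^ 2 := by rw [← pow_add]; congr 1; omega
      rw [e1] at huc
      have h5 : A T * R ^ (p - 1) * (μ / (p + 1)) * R ^ 2 < 4 * R ^ 2 := by
        have := mul_le_mul_of_nonneg_left huc hATnn
        push_cast at this
        linarith
      have h6 := lt_of_mul_lt_mul_right h5 (sq_nonneg R)
      rw [lt_div_iff₀ hμ]
      rw [mul_div_assoc', div_lt_iff₀ (by positivity)] at h6
      linarith
    have h7 : A T * γ * (3 * R) ^ (p - 1) < 3 ^ (p - 1) * (4 * (p + 1)) * (γ / μ) := by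
      calc A T * γ * (3 * R) ^ (p - 1) = 3 ^ (p - 1) * γ * (A T * R ^ (p - 1)) := by
            rw [mul_pow]; ring
        _ < 3 ^ (p - 1) * γ * (4 * (p + 1) / μ) := by gcongr
        _ = _ := by ring
    have h8 := pow_lt_pow_left₀ h7 (by positivity) two_ne_zero
    linarith

theorem candidates_subset (hZ : IsCompact Z) (hc : Convex ℝ Z) (hγ : 0 ≤ γ)
    (hprox : IsProxOracle p Z grad δ γ iProx) (hz0 : z0 ∈ Z) :
    candidates p γ Z iGrad iProx T z0 ⊆ Z := by
  rintro w ⟨t, ht, hw⟩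
  by_cases hne : (init p γ iProx z0).lamP = 0
  · rw [epochLength, if_pos hne] at ht
    obtain rfl : t = 0 := by omega
    rcases hw with rfl | rfl <;> exact hz0
  · have hv := isValid_epochState (iGrad := iGrad) hZ hc hγ hprox hz0 hne t
    rcases hw with rfl | rfl
    exacts [hv.z_mem, hv.zt_mem]

theorem IsEpochOutput.mem (hout : IsEpochOutput p γ Z iFunc iGrad iProx T z0 z1)
    (hZ : IsCompact Z) (hc : Convex ℝ Z) (hγ : 0 ≤ γ)
    (hprox : IsProxOracle p Z grad δ γ iProx) (hz0 : z0 ∈ Z) : z1 ∈ Z :=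
  candidates_subset hZ hc hγ hprox hz0 hout.1

theorem IsEpochOutput.le_add (hout : IsEpochOutput p γ Z iFunc iGrad iProx T z0 z1)
    (hZ : IsCompact Z) (hc : Convex ℝ Z) (hγ : 0 ≤ γ)
    (hprox : IsProxOracle p Z grad δ γ iProx) (hfunc : IsZerothOrderOracle Z h δ iFunc)
    (hz0 : z0 ∈ Z) {w : E} (hw : w ∈ candidates p γ Z iGrad iProx T z0) : h z1 ≤ h w + 2 * δ := by
  have h1 := abs_le.1 (hfunc z1 (hout.mem hZ hc hγ hprox hz0))
  have h2 := abs_le.1 (hfunc w (candidates_subset hZ hc hγ hprox hz0 hw))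
  have h3 := hout.2 w hw
  linarith [h1.1, h2.2]

theorem start_mem_candidates (p : ℕ) (γ : ℝ) (Z : Set E) (iGrad : E → E) (iProx : E → E × E)
    (T : ℕ) (z0 : E) : z0 ∈ candidates p γ Z iGrad iProx T z0 :=
  ⟨0, Nat.zero_le _, Or.inl rfl⟩

/-- An epoch that starts far from the minimum halves the distance to the minimal value, up to the
accuracy `ε`. -/
theorem IsEpochOutput.sub_le_max [CompleteSpace E]
    (hout : IsEpochOutput p γ Z iFunc iGrad iProx T z0 z1) (hp : 1 ≤ p) (hZ : IsCompact Z)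
    (hc : Convex ℝ Z) (hμ : 0 < μ) (hγ : 0 < γ) (hε : 0 < ε)
    (hδ : 0 ≤ δ) (hdiff : HasGradientWithinAt h (grad zstar) Z zstar)
    (hh : UniformlyConvexOn (p + 1) μ Z h grad) (hfunc : IsZerothOrderOracle Z h δ iFunc)
    (hgrad : IsFirstOrderOracle Z grad δ iGrad)
    (hprox : IsProxOracle p Z grad δ γ iProx) (hz0 : z0 ∈ Z) (hstar : zstar ∈ Z)
    (hmin : IsMinOn h Z zstar) (hT : 1 ≤ T)
    (hgrowth : ∀ (γ ρ : ℝ) (n : ℕ) (A L a r : ℕ → ℝ), 0 < γ → 0 < ρ → 1 ≤ n →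
      IsSearchFreeSeq p γ n A L a r →
      ∑ t ∈ Finset.range n, movement p γ A L a r t ≤ ρ ^ 2 →
      c * (n : ℝ) ^ (3 * p + 1) ≤ (A n * γ * ρ ^ (p - 1)) ^ 2)
    (hcT : (3 ^ (p - 1) * (4 * (p + 1)) * (γ / μ)) ^ 2 ≤ c * (T : ℝ) ^ (3 * p + 1))
    (hfar : ε / 2 ≤ h z0 - h zstar) (hδε : δ ≤ ε / 16) (hδD : δ * Metric.diam Z ≤ ε / 16) :
    h z1 - h zstar ≤ max ((h z0 - h zstar) / 2) (9 / 16 * ε) := by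
  by_cases hne : (init p γ iProx z0).lamP = 0
  -- A zero weight means that the proximal step stays at `z0`, so the gap is at most 7δD ≤ 7ε/16,
  -- against `hfar`.
  · exfalso
    have hr : (iProx z0).1 = z0 := by
      change γ * ‖(iProx z0).1 - z0‖ ^ (p - 1) = 0 at hne
      have := eq_zero_of_pow_eq_zero ((mul_eq_zero.1 hne).resolve_left hγ.ne')
      exact sub_eq_zero.1 (norm_eq_zero.1 this)
    have hs := sub_le_of_short_step hZ hμ.le hγ.le hh hprox hstar hz0
      (by rw [hr, sub_self, norm_zero, mul_zero]; positivity)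
    rw [hr] at hs
    linarith
  · have hlen : epochLength p γ iProx T z0 = T := by rw [epochLength, if_neg hne]
    rcases exists_near_min hp hZ hc hμ hγ hδ hdiff hh hgrad hprox hz0 hstar hmin hne hT hgrowth hcT
      (by linarith) (by linarith) with ⟨t, ht, hnear⟩ | hnear
    · have := hout.le_add hZ hc hγ.le hprox hfunc hz0 (w := _) ⟨t, ht.trans hlen.ge, Or.inr rfl⟩
      -- Here 7δD + 2δ ≤ 9ε/16; in the other case e/8 + δD + 2δ ≤ e/8 + 3ε/16 ≤ e/2, since ε ≤ 2e.
      exact le_max_of_le_right (by linarith)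
    · have := hout.le_add hZ hc hγ.le hprox hfunc hz0 (w := _) ⟨T, hlen.ge, Or.inl rfl⟩
      exact le_max_of_le_left (by linarith)

end Epoch

/-! ### Error threshold and iteration counts. -/

theorem le_of_le_errorThreshold {p : ℕ} {μ D Δ ε δ : ℝ} (hε : 0 < ε) (hΔ : ε < Δ) (hδ : 0 ≤ δ)
    (h : δ ≤ errorThreshold p μ D Δ ε) : δ ≤ ε / 16 ∧ δ * D ≤ ε / 16 := by
  have h1 : δ ≤ ε ^ 2 / (2 ^ 4 * max D 1 * Δ) := h.trans (min_le_right _ _)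
  have hΔ0 : 0 < Δ := hε.trans hΔ
  have hM : 1 ≤ max D 1 := le_max_right _ _
  rw [le_div_iff₀ (by positivity)] at h1
  have h2 : δ * max D 1 ≤ ε / 16 := by
    have h3 : δ * max D 1 * 16 * ε ≤ ε * ε := by
      calc δ * max D 1 * 16 * ε ≤ δ * max D 1 * 16 * Δ := by gcongr
        _ = δ * (2 ^ 4 * max D 1 * Δ) := by ring
        _ ≤ _ := by rw [← sq]; exact h1
    linarith [le_of_mul_le_mul_right h3 hε]
  exact ⟨(le_mul_of_one_le_right hδ hM).trans h2,
    (mul_le_mul_of_nonneg_left (le_max_left _ _) hδ).trans h2⟩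

theorem le_two_pow_numEpochs {Δ ε : ℝ} (hε : 0 < ε) (hΔ : 0 < Δ) :
    Δ / 2 ^ numEpochs Δ ε ≤ ε := by
  have h1 : Real.logb 2 (Δ / ε) ≤ numEpochs Δ ε := Nat.le_ceil _
  rw [Real.logb_le_iff_le_rpow (by norm_num) (by positivity), Real.rpow_natCast,
    div_le_iff₀ hε] at h1
  rw [div_le_iff₀ (by positivity)]
  linarith

theorem numEpochs_eq_zero {Δ ε : ℝ} (hε : 0 < ε) (hΔ : 0 ≤ Δ) (hle : Δ ≤ ε) :
    numEpochs Δ ε = 0 :=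
  Nat.ceil_eq_zero.2 (Real.logb_nonpos (by norm_num) (by positivity) (by rwa [div_le_one hε]))

theorem rate_pos (p : ℕ) {γ μ : ℝ} (hγ : 0 < γ) (hμ : 0 < μ) : 0 < rate p γ μ := by
  unfold rate; positivity

theorem rate_pow (p : ℕ) {γ μ : ℝ} (hγ : 0 < γ) (hμ : 0 < μ) :
    rate p γ μ ^ (3 * p + 1) = (γ / μ) ^ 2 := by
  rw [rate, ← Real.rpow_natCast, ← Real.rpow_mul (by positivity), ← Real.rpow_natCast (γ / μ)]
  congr 1; push_cast; field_simp

theorem natCeil_mul_le {c x : ℝ} (hc : 0 ≤ c) (hx : 0 ≤ x) :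
    (⌈c * x⌉₊ : ℝ) ≤ (c + 1) * max 1 x := by
  have h1 := (Nat.ceil_lt_add_one (show 0 ≤ c * x by positivity)).le
  have h2 : c * x ≤ c * max 1 x := by gcongr; exact le_max_right _ _
  linarith [le_max_left 1 x]

theorem numEpochs_le (Δ ε : ℝ) :
    (numEpochs Δ ε : ℝ) ≤ 2 * max 1 (Real.logb 2 (Δ / ε)) := by
  have h1 : (numEpochs Δ ε : ℝ) ≤ ⌈max 1 (Real.logb 2 (Δ / ε))⌉₊ := by
    exact_mod_cast Nat.ceil_mono (le_max_right _ _)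
  have h2 : (1 : ℝ) ≤ max 1 (Real.logb 2 (Δ / ε)) := le_max_left _ _
  linarith [(Nat.ceil_lt_add_one (zero_le_one.trans h2)).le]

end AIPE

end

/-! ### Restarting. -/

/-- The factor `max 1 (Real.logb 2 (Δ / ε))` merges the two regimes: it is 1 for Δ ≤ 2ε and the
logarithm for Δ > 2ε. -/
theorem mainTheorem4 (p : ℕ) (hp : 1 ≤ p) :
    ∃ C₁ > (0 : ℝ), ∃ C₂ > (0 : ℝ),
      ∀ (d : ℕ) (Z : Set (EuclideanSpace ℝ (Fin d)))
        (h : EuclideanSpace ℝ (Fin d) → ℝ)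
        (grad : EuclideanSpace ℝ (Fin d) → EuclideanSpace ℝ (Fin d))
        (iFunc : EuclideanSpace ℝ (Fin d) → ℝ)
        (iGrad : EuclideanSpace ℝ (Fin d) → EuclideanSpace ℝ (Fin d))
        (iProx : EuclideanSpace ℝ (Fin d) → EuclideanSpace ℝ (Fin d) × EuclideanSpace ℝ (Fin d))
        (z0 zstar : EuclideanSpace ℝ (Fin d)) (μ γ δ ε Δ : ℝ) (T S : ℕ),
        0 < μ → 0 < γ → 0 < ε →
        IsCompact Z → Convex ℝ Z →
        (∀ z ∈ Z, HasGradientWithinAt h (grad z) Z z) →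
        AIPE.UniformlyConvexOn (p + 1) μ Z h grad →
        AIPE.IsZerothOrderOracle Z h δ iFunc →
        AIPE.IsFirstOrderOracle Z grad δ iGrad →
        AIPE.IsProxOracle p Z grad δ γ iProx →
        z0 ∈ Z → zstar ∈ Z → IsMinOn h Z zstar →
        Δ = h z0 - h zstar →
        (0 < Δ → δ ≤ AIPE.errorThreshold p μ (Metric.diam Z) Δ ε) →
        T = ⌈C₁ * AIPE.rate p γ μ⌉₊ →
        S = AIPE.numEpochs Δ ε →
        (T : ℝ) ≤ C₂ * max 1 (AIPE.rate p γ μ) ∧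
        (T : ℝ) * S ≤ C₂ * (max 1 (AIPE.rate p γ μ) * max 1 (Real.logb 2 (Δ / ε))) ∧
        ∀ zs : ℕ → EuclideanSpace ℝ (Fin d),
          AIPE.IsRun p γ Z iFunc iGrad iProx T S z0 zs →
            zs S ∈ Z ∧ h (zs S) - h zstar ≤ ε := by
  obtain ⟨c, hc, hgrowth⟩ := AIPE.exists_pow_le_of_movement_le hp
  set K : ℝ := (3 ^ (p - 1) * (4 * (p + 1))) ^ 2 with hK
  have hK0 : 0 < K := by positivity
  -- Since C₁ ≥ 1, C₁^(3p+1) ≥ C₁ ≥ K/c, which avoids taking a root.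
  set C₁ : ℝ := 1 + K / c with hC₁
  have hC₁1 : 1 ≤ C₁ := le_add_of_nonneg_right (by positivity)
  refine ⟨C₁, by positivity, 2 * (C₁ + 1), by positivity, ?_⟩
  intro d Z h grad iFunc iGrad iProx z0 zstar μ γ δ ε Δ T S hμ hγ hε hZ hconv hdiff hh hfunc hgrad
    hprox hz0 hstar hmin hΔ hthr hT hS
  have hrate := AIPE.rate_pos p hγ hμ
  have hTle : (T : ℝ) ≤ (C₁ + 1) * max 1 (AIPE.rate p γ μ) :=
    hT ▸ AIPE.natCeil_mul_le (by positivity) hrate.le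
  have hSle : (S : ℝ) ≤ 2 * max 1 (Real.logb 2 (Δ / ε)) := hS ▸ AIPE.numEpochs_le Δ ε
  have hm1 : 0 < max 1 (AIPE.rate p γ μ) := lt_max_of_lt_left one_pos
  refine ⟨hTle.trans (by gcongr; linarith), ?_, fun zs hrun => ?_⟩
  · calc (T : ℝ) * S ≤ (C₁ + 1) * max 1 (AIPE.rate p γ μ) * (2 * max 1 (Real.logb 2 (Δ / ε))) := by
          gcongr
      _ = _ := by ring
  have hδ : 0 ≤ δ := (abs_nonneg _).trans (hfunc z0 hz0)
  have hΔ0 : 0 ≤ Δ := hΔ ▸ sub_nonneg.2 (hmin hz0)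
  obtain ⟨hrun0, hrunS⟩ := hrun
  rcases le_or_gt Δ ε with hle | hgt
  · rw [hS, AIPE.numEpochs_eq_zero hε hΔ0 hle, hrun0, ← hΔ]
    exact ⟨hz0, hle⟩
  have hΔpos : 0 < Δ := hε.trans hgt
  obtain ⟨hδε, hδD⟩ := AIPE.le_of_le_errorThreshold hε hgt hδ (hthr hΔpos)
  have hTceil : C₁ * AIPE.rate p γ μ ≤ T := hT ▸ Nat.le_ceil _
  have hT1 : 1 ≤ T := hT ▸ Nat.one_le_ceil_iff.2 (by positivity)
  have hcT : (3 ^ (p - 1) * (4 * (p + 1)) * (γ / μ)) ^ 2 ≤ c * (T : ℝ) ^ (3 * p + 1) := by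
    calc (3 ^ (p - 1) * (4 * ((p : ℝ) + 1)) * (γ / μ)) ^ 2 = c * (K / c) * (γ / μ) ^ 2 := by
          rw [mul_div_cancel₀ _ hc.ne', hK]; ring
      _ ≤ c * C₁ ^ (3 * p + 1) * (γ / μ) ^ 2 := by
          gcongr
          exact (show K / c ≤ C₁ by linarith).trans (le_self_pow₀ hC₁1 (by omega))
      _ = c * (C₁ * AIPE.rate p γ μ) ^ (3 * p + 1) := by
          rw [mul_pow, AIPE.rate_pow p hγ hμ]; ring
      _ ≤ _ := by gcongr
  -- The floor 5ε/8 is ε/2 + 2δ at δ = ε/16: an epoch started below ε/2 can lose 2δ through inexact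
  -- comparison of values.
  have hinv : ∀ s ≤ S, zs s ∈ Z ∧ h (zs s) - h zstar ≤ max (Δ / 2 ^ s) (5 / 8 * ε) := by
    intro s
    induction s with
    | zero =>
      intro _
      rw [hrun0, pow_zero, div_one, ← hΔ]
      exact ⟨hz0, le_max_left _ _⟩
    | succ s ih =>
      intro hs
      obtain ⟨hmem, hval⟩ := ih (by omega)
      have hout := hrunS s (by omega)
      refine ⟨hout.mem hZ hconv hγ.le hprox hmem, ?_⟩
      rcases le_or_gt (ε / 2) (h (zs s) - h zstar) with hfar | hnear
      · refine (hout.sub_le_max hp hZ hconv hμ hγ hε hδ (hdiff _ hstar) hh hfunc hgrad hprox hmem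
          hstar hmin hT1 hgrowth hcT hfar hδε hδD).trans (max_le ?_ ?_)
        · rcases le_max_iff.1 hval with h1 | h1
          · refine le_max_of_le_left ?_
            rw [pow_succ, ← div_div]; linarith
          · exact le_max_of_le_right (by linarith)
        · exact le_max_of_le_right (by linarith)
      · have := hout.le_add hZ hconv hγ.le hprox hfunc hmem
          (AIPE.start_mem_candidates p γ Z iGrad iProx T (zs s))
        exact le_max_of_le_right (by linarith)
  obtain ⟨h1, h2⟩ := hinv S le_rfl
  refine ⟨h1, h2.trans (max_le ?_ (by linarith))⟩
  rw [hS]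
  exact AIPE.le_two_pow_numEpochs hε hΔpos
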